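/- Let $\mathcal H$ be a separable infinite-dimensional complex Hilbert space, $\mathcal B(\mathcal H)$ the bounded operators on it, $\mathcal K(\mathcal H)$ the compact operators, $\mathcal Q(\mathcal H)=\mathcal B(\mathcal H)/\mathcal K(\mathcal H)$ the Calkin algebra and $\pi:\mathcal B(\mathcal H)\to\mathcal Q(\mathcal H)$ the quotient map. An operator subsystem of a unital $C^*$-algebra is a self-adjoint linear subspace containing the unit. A linear map $\varphi:\mathcal S\to\mathcal Q(\mathcal H)$ on an operator subsystem $\mathcal S$ has a ucp lift to $\mathcal B(\mathcal H)$ if there is a unital completely positive map $\psi:\mathcal S\to\mathcal B(\mathcal H)$ with $\pi\circ\psi=\varphi$. For a unital $C^*$-algebra $\mathcal A$, $\mathrm{Ext}(\mathcal A)$ is the set of injective unital $*$-homomorphisms $\mathcal A\to\mathcal Q(\mathcal H)$ modulo conjugation by elements $\pi(U)$, $U\in\mathcal B(\mathcal H)$ unitary, with the addition $[\rho]+[\sigma]=[W(\rho\oplus\sigma)(\cdot)W^*]$ for any unitary $W:\mathcal H\oplus\mathcal H\to\mathcal H$. **Corollary.** Let $\mathcal A$ be a finitely generated unital $C^*$-algebra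 such that $\mathrm{Ext}(\mathcal A)$ is not a group, and let $\rho:\mathcal A\to\mathcal Q(\mathcal H)$ be an injective unital $*$-homomorphism with no ucp lift to $\mathcal B(\mathcal H)$. Then there exist an integer $n\ge 1$, a $4$-dimensional operator subsystem $\mathcal S$ of $M_{n+1}(\mathcal A)$ and a unitary $V:\mathcal H\otimes\mathbb C^{n+1}\to\mathcal H$ such that the map $V(\rho\otimes\mathrm{id}_{n+1})(\cdot)V^*:\mathcal S\to\mathcal Q(\mathcal H)$ has no ucp lift to $\mathcal B(\mathcal H)$. Here $q\mapsto VqV^*$ denotes the $*$-homomorphism $M_{n+1}(\mathcal Q(\mathcal H))\to\mathcal Q(\mathcal H)$ sending the class $[\pi(T_{ij})]_{i,j}$ of $T=[T_{ij}]\in M_{n+1}(\mathcal B(\mathcal H))=\mathcal B(\mathcal H\otimes\mathbb C^{n+1})$ to $\pi(VTV^*)$. -/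

import Mathlib

open scoped InnerProductSpace

noncomputable section

/-! ### The Calkin algebra -/

section Calkin

variable (H : Type*) [NormedAddCommGroup H] [InnerProductSpace ℂ H] [CompleteSpace H]

/-- The adjoint of a compact operator is compact. -/
theorem isCompactOperator_star {H : Type*} [NormedAddCommGroup H] [InnerProductSpace ℂ H]
    [CompleteSpace H] {T : H →L[ℂ] H} (hT : IsCompactOperator T) :
    IsCompactOperator (star T : H →L[ℂ] H) := by
  have hS : IsCompactOperator (T * star T : H →L[ℂ] H) := hT.comp_clm (star T)
  have hS' : TotallyBounded ((T * star T : H →L[ℂ] H) '' Metric.closedBall 0 1) := by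
    have h := hS.isCompact_closure_image_closedBall (𝕜₁ := ℂ) (𝕜₂ := ℂ)
      (f := ((T * star T : H →L[ℂ] H) : H →ₗ[ℂ] H)) 1
    exact h.totallyBounded.subset subset_closure
  have key : TotallyBounded ((star T : H →L[ℂ] H) '' Metric.closedBall 0 1) := by
    rw [Metric.totallyBounded_iff]
    intro ε hε
    obtain ⟨t, hts, htf, hcov⟩ :=
      Metric.finite_approx_of_totallyBounded hS' (ε ^ 2 / 2) (by positivity)
    obtain ⟨u, hu, rfl⟩ := Set.subset_image_iff.1 hts
    obtain ⟨u', hu', hbij⟩ := Set.exists_subset_bijOn u (T * star T : H →L[ℂ] H)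
    have hfin : u'.Finite := Set.Finite.of_finite_image (hbij.image_eq ▸ htf) hbij.injOn
    refine ⟨(star T : H →L[ℂ] H) '' u', hfin.image _, ?_⟩
    rintro _ ⟨x, hx, rfl⟩
    obtain ⟨y, hy, hxy⟩ := Set.mem_iUnion₂.1 (hcov ⟨x, hx, rfl⟩)
    rw [← hbij.image_eq] at hy
    obtain ⟨z, hz, rfl⟩ := hy
    refine Set.mem_iUnion₂.2 ⟨_, ⟨z, hz, rfl⟩, ?_⟩
    rw [Metric.mem_ball, dist_eq_norm, ← map_sub] at hxy ⊢
    have hxz : ‖x - z‖ ≤ 2 := by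
      have h1 : ‖x‖ ≤ 1 := by simpa using hx
      have h2 : ‖z‖ ≤ 1 := by simpa using hu (hu' hz)
      linarith [norm_sub_le x z]
    have hsq : ‖(star T : H →L[ℂ] H) (x - z)‖ ^ 2
        ≤ ‖(T * star T : H →L[ℂ] H) (x - z)‖ * ‖x - z‖ := by
      have h1 := ContinuousLinearMap.apply_norm_sq_eq_inner_adjoint_left (star T) (x - z)
      rw [h1, ← ContinuousLinearMap.star_eq_adjoint, star_star]
      exact (RCLike.re_le_norm _).trans (norm_inner_le_norm _ _)
    have : ‖(star T : H →L[ℂ] H) (x - z)‖ ^ 2 < ε ^ 2 := by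
      nlinarith [norm_nonneg ((T * star T : H →L[ℂ] H) (x - z)), norm_nonneg (x - z)]
    exact lt_of_pow_lt_pow_left₀ 2 hε.le this
  have := (isCompactOperator_iff_isCompact_closure_image_closedBall (𝕜₁ := ℂ) (𝕜₂ := ℂ)
    ((star T : H →L[ℂ] H) : H →ₗ[ℂ] H) one_pos).2
    (key.closure.isCompact_of_isClosed isClosed_closure)
  exact this

/-- The ideal `K(H)` of compact operators in `B(H)`. -/
def compactIdeal : Ideal (H →L[ℂ] H) where
  carrier := {T | IsCompactOperator T}
  add_mem' ha hb := ha.add hb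
  zero_mem' := isCompactOperator_zero
  smul_mem' c _ hx := hx.clm_comp c

instance : (compactIdeal H).IsTwoSided where
  mul_mem_of_left b ha := IsCompactOperator.comp_clm ha b

/-- The Calkin algebra `Q(H) = B(H) / K(H)`. -/
abbrev Calkin : Type _ := (H →L[ℂ] H) ⧸ compactIdeal H

/-- The involution of the Calkin algebra, induced by the adjoint. -/
instance : Star (Calkin H) where
  star := Quotient.map' star (by
    intro a b hab
    rw [Submodule.quotientRel_def] at hab ⊢
    rw [← star_sub]
    exact isCompactOperator_star hab)

instance : StarRing (Calkin H) where
  star_involutive := by rintro ⟨a⟩; exact congrArg (Ideal.Quotient.mk _) (star_star a)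
  star_mul := by rintro ⟨a⟩ ⟨b⟩; exact congrArg (Ideal.Quotient.mk _) (star_mul a b)
  star_add := by rintro ⟨a⟩ ⟨b⟩; exact congrArg (Ideal.Quotient.mk _) (star_add a b)

instance : StarModule ℂ (Calkin H) where
  star_smul := by rintro c ⟨a⟩; exact congrArg (Ideal.Quotient.mk _) (star_smul c a)

/-- The canonical quotient map `π : B(H) → Q(H)`. -/
def calkinMk : (H →L[ℂ] H) →⋆ₐ[ℂ] Calkin H :=
  { Ideal.Quotient.mkₐ ℂ (compactIdeal H) with map_star' := fun _ => rfl }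

end Calkin

/-! ### Conjugation by a unitary `H ⊗ ℂᵏ → H` -/

section Conj

variable {H : Type*} [NormedAddCommGroup H]

/-- The Hilbert space `H ⊗ ℂᵏ`, realised as the Hilbert space direct sum of `k` copies of `H`. -/
abbrev HilbertPow (H : Type*) [NormedAddCommGroup H] (k : ℕ) : Type _ :=
  PiLp 2 (fun _ : Fin k => H)

theorem hilbertPow_single_apply {k : ℕ} (i j : Fin k) (h : H) :
    (PiLp.single 2 j h : HilbertPow H k) i = if i = j then h else 0 := by
  rw [PiLp.ofLp_single, Pi.single_apply]

theorem hilbertPow_sum_single {k : ℕ} (x : HilbertPow H k) :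
    ∑ i, (PiLp.single 2 i (x i) : HilbertPow H k) = x := by
  ext i
  simp

variable [InnerProductSpace ℂ H]

/-- The embedding `h ↦ h ⊗ eᵢ` of `H` into `H ⊗ ℂᵏ`. -/
def hilbertIncl {k : ℕ} (i : Fin k) : H →L[ℂ] HilbertPow H k :=
  LinearMap.mkContinuous
    { toFun := fun h => PiLp.single 2 i h
      map_add' := fun a b => PiLp.single_add 2 i
      map_smul' := fun c a => by
        rw [← PiLp.toLp_single, ← PiLp.toLp_single, Pi.single_smul]; rfl } 1
    (fun h => by simp)

/-- The `i`-th column `Vᵢ = V (· ⊗ eᵢ) : H → H` of a unitary `V : H ⊗ ℂᵏ → H`. -/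
def unitaryCol {k : ℕ} (V : HilbertPow H k ≃ₗᵢ[ℂ] H) (i : Fin k) : H →L[ℂ] H :=
  (V.toContinuousLinearEquiv : HilbertPow H k →L[ℂ] H) ∘L hilbertIncl i

/-- The operator on `H ⊗ ℂᵏ` given by a `k × k` matrix of operators on `H`. -/
def matrixOp {k : ℕ} (T : Matrix (Fin k) (Fin k) (H →L[ℂ] H)) :
    HilbertPow H k →L[ℂ] HilbertPow H k :=
  ∑ i, ∑ j, hilbertIncl i ∘L T i j ∘L PiLp.proj 2 (fun _ : Fin k => H) j

theorem hilbertIncl_apply {k : ℕ} (i : Fin k) (h : H) :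
    hilbertIncl i h = PiLp.single 2 i h := rfl

theorem unitaryCol_apply {k : ℕ} (V : HilbertPow H k ≃ₗᵢ[ℂ] H) (i : Fin k) (h : H) :
    unitaryCol V i h = V (PiLp.single 2 i h) := rfl

theorem matrixOp_apply {k : ℕ} (T : Matrix (Fin k) (Fin k) (H →L[ℂ] H)) (x : HilbertPow H k)
    (i : Fin k) : matrixOp T x i = ∑ j, T i j (x j) := by
  simp only [matrixOp, sum_apply, ContinuousLinearMap.comp_apply,
    hilbertIncl_apply, PiLp.proj_apply, WithLp.ofLp_sum, Finset.sum_apply, hilbertPow_single_apply]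
  rw [Finset.sum_eq_single i] <;> simp +contextual [eq_comm]

variable [CompleteSpace H]

theorem star_unitaryCol_apply {k : ℕ} (V : HilbertPow H k ≃ₗᵢ[ℂ] H) (i : Fin k) (h : H) :
    (star (unitaryCol V i) : H →L[ℂ] H) h = V.symm h i := by
  refine ext_inner_right ℂ fun g => ?_
  rw [ContinuousLinearMap.star_eq_adjoint, ContinuousLinearMap.adjoint_inner_left,
    unitaryCol_apply, ← V.symm.inner_map_map, V.symm_apply_apply, PiLp.inner_apply,
    Finset.sum_eq_single i] <;> simp +contextual

theorem star_unitaryCol_mul {k : ℕ} (V : HilbertPow H k ≃ₗᵢ[ℂ] H) (i j : Fin k) :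
    star (unitaryCol V i) * unitaryCol V j = if i = j then 1 else 0 := by
  ext h
  rw [mul_apply_eq_comp, star_unitaryCol_apply, unitaryCol_apply,
    V.symm_apply_apply, hilbertPow_single_apply]
  split_ifs <;> rfl

theorem sum_unitaryCol_mul_star {k : ℕ} (V : HilbertPow H k ≃ₗᵢ[ℂ] H) :
    ∑ i, unitaryCol V i * star (unitaryCol V i) = 1 := by
  ext h
  simp only [sum_apply, mul_apply_eq_comp, star_unitaryCol_apply,
    unitaryCol_apply, one_apply_eq_self, ← map_sum, hilbertPow_sum_single]
  simp

theorem star_unitaryCol_mul_assoc {k : ℕ} (V : HilbertPow H k ≃ₗᵢ[ℂ] H) (i j : Fin k)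
    (x : H →L[ℂ] H) :
    star (unitaryCol V i) * (unitaryCol V j * x) = if i = j then x else 0 := by
  rw [← mul_assoc, star_unitaryCol_mul, ite_mul, one_mul, zero_mul]

theorem calkinMk_star_unitaryCol_mul {k : ℕ} (V : HilbertPow H k ≃ₗᵢ[ℂ] H) (i j : Fin k) :
    star (calkinMk H (unitaryCol V i)) * calkinMk H (unitaryCol V j) =
      if i = j then 1 else 0 := by
  rw [← map_star, ← map_mul, star_unitaryCol_mul]
  split_ifs <;> simp

theorem calkinMk_star_unitaryCol_mul_assoc {k : ℕ} (V : HilbertPow H k ≃ₗᵢ[ℂ] H) (i j : Fin k)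
    (x : Calkin H) :
    star (calkinMk H (unitaryCol V i)) * (calkinMk H (unitaryCol V j) * x) =
      if i = j then x else 0 := by
  rw [← mul_assoc, calkinMk_star_unitaryCol_mul, ite_mul, one_mul, zero_mul]

theorem sum_calkinMk_unitaryCol {k : ℕ} (V : HilbertPow H k ≃ₗᵢ[ℂ] H) :
    ∑ i, calkinMk H (unitaryCol V i) * star (calkinMk H (unitaryCol V i)) = 1 := by
  simp only [← map_star, ← map_mul, ← map_sum, sum_unitaryCol_mul_star, map_one]

/-- The map `M_k(Q(H)) → Q(H)`, `q ↦ V q V*`, induced by a unitary `V : H ⊗ ℂᵏ → H`: in terms of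
the columns of `V` it is `q ↦ ∑ᵢⱼ π(Vᵢ) qᵢⱼ π(Vⱼ)*`. By `calkinConj_map_calkinMk` it sends the
class of a matrix of operators `T` to the class of the operator `V T V*`. -/
def calkinConj {k : ℕ} (V : HilbertPow H k ≃ₗᵢ[ℂ] H) :
    Matrix (Fin k) (Fin k) (Calkin H) →⋆ₐ[ℂ] Calkin H where
  toFun q := ∑ i, ∑ j,
    calkinMk H (unitaryCol V i) * q i j * star (calkinMk H (unitaryCol V j))
  map_one' := by
    simp only [Matrix.one_apply, mul_ite, mul_one, mul_zero, ite_mul, zero_mul,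
      Finset.sum_ite_eq, Finset.mem_univ, if_true]
    exact sum_calkinMk_unitaryCol V
  map_mul' M N := by
    have h (l : Fin k) : star (calkinMk H (unitaryCol V l)) * (∑ m, ∑ j,
        calkinMk H (unitaryCol V m) * N m j * star (calkinMk H (unitaryCol V j)))
        = ∑ j, N l j * star (calkinMk H (unitaryCol V j)) := by
      simp only [Finset.mul_sum, ← mul_assoc, calkinMk_star_unitaryCol_mul]
      rw [Finset.sum_eq_single l] <;> simp +contextual [eq_comm]
    simp only [Finset.sum_mul, mul_assoc] at h ⊢
    simp only [h, Matrix.mul_apply, Finset.sum_mul, Finset.mul_sum, mul_assoc]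
    exact Finset.sum_congr rfl fun i _ => Finset.sum_comm
  map_zero' := by simp
  map_add' M N := by
    simp only [Matrix.add_apply, mul_add, add_mul, Finset.sum_add_distrib]
  commutes' c := by
    have h := sum_calkinMk_unitaryCol V
    simp only [Matrix.algebraMap_matrix_apply, mul_ite, mul_zero, ite_mul, zero_mul,
      Finset.sum_ite_eq, Finset.mem_univ, if_true]
    simp only [← Algebra.commutes c, mul_assoc, ← Finset.mul_sum, h, mul_one]
  map_star' M := by
    simp only [star_sum, star_mul, star_star, Matrix.star_apply, mul_assoc]
    exact Finset.sum_comm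

theorem calkinConj_apply {k : ℕ} (V : HilbertPow H k ≃ₗᵢ[ℂ] H)
    (q : Matrix (Fin k) (Fin k) (Calkin H)) : calkinConj V q =
      ∑ i, ∑ j, calkinMk H (unitaryCol V i) * q i j * star (calkinMk H (unitaryCol V j)) := rfl

theorem calkinConj_map_calkinMk {k : ℕ} (V : HilbertPow H k ≃ₗᵢ[ℂ] H)
    (T : Matrix (Fin k) (Fin k) (H →L[ℂ] H)) :
    calkinConj V (T.map (calkinMk H)) = calkinMk H
      ((V.toContinuousLinearEquiv : HilbertPow H k →L[ℂ] H) ∘L matrixOp T ∘L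
        (V.symm.toContinuousLinearEquiv : H →L[ℂ] HilbertPow H k)) := by
  simp only [calkinConj_apply, Matrix.map_apply, ← map_star, ← map_mul, ← map_sum]
  congr 1
  ext h
  have (x : HilbertPow H k) : x = ∑ i, PiLp.single 2 i (x i) := (hilbertPow_sum_single x).symm
  simp only [sum_apply, mul_apply_eq_comp, star_unitaryCol_apply,
    unitaryCol_apply, ContinuousLinearMap.comp_apply]
  change _ = V (matrixOp T (V.symm h))
  rw [this (matrixOp T (V.symm h)), map_sum]
  refine Finset.sum_congr rfl fun i _ => ?_
  rw [matrixOp_apply, ← hilbertIncl_apply, map_sum, map_sum]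
  rfl

/-- The entrywise application `ρ ⊗ id : M_k(A) → M_k(Q(H))` of a unital
`*`-homomorphism `ρ : A → Q(H)`. -/
def ampliation {A : Type*} [CStarAlgebra A] (k : ℕ) (ρ : A →⋆ₐ[ℂ] Calkin H) :
    CStarMatrix (Fin k) (Fin k) A →⋆ₐ[ℂ] Matrix (Fin k) (Fin k) (Calkin H) where
  toFun x := Matrix.of fun i j => ρ (x i j)
  map_one' := by ext i j; by_cases h : i = j <;> simp [CStarMatrix.one_apply, Matrix.one_apply, h]
  map_mul' x y := by ext i j; simp [CStarMatrix.mul_apply, Matrix.mul_apply]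
  map_zero' := by ext i j; simp
  map_add' x y := by ext i j; simp
  commutes' c := by
    ext i j
    by_cases h : i = j <;>
      simp [CStarMatrix.algebraMap_apply, Matrix.algebraMap_matrix_apply, AlgHomClass.commutes, h]
  map_star' x := by ext i j; simp [Matrix.star_apply, CStarMatrix.star_apply, map_star]

end Conj

/-! ### Operator systems and ucp lifts -/

section OperatorSystem

variable (B : Type*) [CStarAlgebra B]

/-- An operator subsystem of a unital C⋆-algebra: a self-adjoint subspace containing the unit. -/
structure OperatorSubsystem extends Submodule ℂ B where
  one_mem' : (1 : B) ∈ carrier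
  star_mem' : ∀ {x : B}, x ∈ carrier → star x ∈ carrier

variable {B}

/-- A unital C⋆-algebra as an operator subsystem of itself. -/
def OperatorSubsystem.all (B : Type*) [CStarAlgebra B] : OperatorSubsystem B where
  toSubmodule := ⊤
  one_mem' := Submodule.mem_top
  star_mem' _ := Submodule.mem_top

/-- A linear map `ψ` from an operator subsystem `S` of `B` to a unital C⋆-algebra `C` is unital
completely positive (ucp) if `ψ(1) = 1` and, for each `k`, the entrywise application of `ψ` sends
the matrices over `S` that are positive in `M_k(B)` to positive elements of `M_k(C)`. -/
structure IsUCP [PartialOrder B] [StarOrderedRing B] {C : Type*} [CStarAlgebra C]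
    [PartialOrder C] [StarOrderedRing C] (S : OperatorSubsystem B)
    (ψ : S.toSubmodule →ₗ[ℂ] C) : Prop where
  map_one : ψ ⟨1, S.one_mem'⟩ = 1
  map_nonneg : ∀ (k : ℕ) (M : CStarMatrix (Fin k) (Fin k) S.toSubmodule),
    0 ≤ M.map (fun s => (s : B)) → 0 ≤ M.map ψ

/-- The restriction of `φ : B → Q(H)` to the operator subsystem `S` has a ucp lift to `B(H)`. -/
def HasUCPLift [PartialOrder B] [StarOrderedRing B] {H : Type*} [NormedAddCommGroup H]
    [InnerProductSpace ℂ H] [CompleteSpace H] (S : OperatorSubsystem B)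
    (φ : B →⋆ₐ[ℂ] Calkin H) : Prop :=
  ∃ ψ : S.toSubmodule →ₗ[ℂ] (H →L[ℂ] H), IsUCP S ψ ∧ ∀ s, calkinMk H (ψ s) = φ s

/-- `A` is finitely generated as a unital C⋆-algebra. -/
def IsFinitelyGeneratedCStar (A : Type*) [CStarAlgebra A] : Prop :=
  ∃ F : Finset A, (StarAlgebra.adjoin ℂ (F : Set A)).topologicalClosure = ⊤

end OperatorSystem

/-! ### The extension semigroup -/

section Ext

variable (A : Type*) [CStarAlgebra A]
  (H : Type*) [NormedAddCommGroup H] [InnerProductSpace ℂ H] [CompleteSpace H]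

/-- The unital extensions of `A` by the compact operators: the injective unital
`*`-homomorphisms `A → Q(H)`. -/
abbrev UnitalExtension : Type _ :=
  {ρ : A →⋆ₐ[ℂ] Calkin H // Function.Injective ρ}

variable {A H}

/-- Two extensions are equivalent if a unitary operator on `H` conjugates one to the other. -/
def ExtEquivalent (ρ σ : UnitalExtension A H) : Prop :=
  ∃ U ∈ unitary (H →L[ℂ] H), ∀ a, σ.1 a = calkinMk H U * ρ.1 a * star (calkinMk H U)

/-- The direct sum `a ↦ W (ρ(a) ⊕ σ(a)) W*` of two extensions, formed with a unitary
`W : H ⊕ H → H`. -/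
def extSum (W : HilbertPow H 2 ≃ₗᵢ[ℂ] H) (ρ σ : UnitalExtension A H) : UnitalExtension A H where
  val := (calkinConj W).comp
    { toFun := fun a => Matrix.diagonal ![ρ.1 a, σ.1 a]
      map_one' := by ext i j; fin_cases i <;> fin_cases j <;> simp
      map_mul' := fun a b => by ext i j; fin_cases i <;> fin_cases j <;> simp
      map_zero' := by ext i j; fin_cases i <;> fin_cases j <;> simp
      map_add' := fun a b => by ext i j; fin_cases i <;> fin_cases j <;> simp
      commutes' := fun c => by
        ext i j; fin_cases i <;> fin_cases j <;> 
          simp [Matrix.algebraMap_matrix_apply, AlgHomClass.commutes]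
      map_star' := fun a => by
        ext i j; fin_cases i <;> fin_cases j <;> simp [Matrix.star_apply, map_star] }
  property := by
    intro a b hab
    apply ρ.2
    have h := congrArg (fun x => star (calkinMk H (unitaryCol W 0)) * x *
      calkinMk H (unitaryCol W 0)) hab
    simpa [calkinConj_apply, mul_add, add_mul, mul_assoc, calkinMk_star_unitaryCol_mul,
      calkinMk_star_unitaryCol_mul_assoc] using h

theorem extSum_apply (W : HilbertPow H 2 ≃ₗᵢ[ℂ] H) (ρ σ : UnitalExtension A H) (a : A) :
    (extSum W ρ σ).1 a =
      calkinMk H (unitaryCol W 0) * ρ.1 a * star (calkinMk H (unitaryCol W 0)) +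
      calkinMk H (unitaryCol W 1) * σ.1 a * star (calkinMk H (unitaryCol W 1)) := by
  simp [extSum, calkinConj_apply]

/-- The direct sum respects equivalence and does not depend on `W` up to equivalence. -/
theorem extSum_equivalent (W W' : HilbertPow H 2 ≃ₗᵢ[ℂ] H) {ρ ρ' σ σ' : UnitalExtension A H}
    (hρ : ExtEquivalent ρ ρ') (hσ : ExtEquivalent σ σ') :
    ExtEquivalent (extSum W ρ σ) (extSum W' ρ' σ') := by
  obtain ⟨u, hu, hu'⟩ := hρ
  obtain ⟨t, ht, ht'⟩ := hσ
  have hW := sum_unitaryCol_mul_star W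
  have hW' := sum_unitaryCol_mul_star W'
  rw [Fin.sum_univ_two] at hW hW'
  rw [Unitary.mem_iff] at hu ht
  have hu1 (x : H →L[ℂ] H) : star u * (u * x) = x := by rw [← mul_assoc, hu.1, one_mul]
  have hu2 (x : H →L[ℂ] H) : u * (star u * x) = x := by rw [← mul_assoc, hu.2, one_mul]
  have ht1 (x : H →L[ℂ] H) : star t * (t * x) = x := by rw [← mul_assoc, ht.1, one_mul]
  have ht2 (x : H →L[ℂ] H) : t * (star t * x) = x := by rw [← mul_assoc, ht.2, one_mul]
  refine ⟨unitaryCol W' 0 * u * star (unitaryCol W 0) +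
    unitaryCol W' 1 * t * star (unitaryCol W 1), ?_, fun a => ?_⟩
  · rw [Unitary.mem_iff]
    constructor
    · simp [mul_add, add_mul, mul_assoc, star_unitaryCol_mul_assoc, hu1, ht1, hW]
    · simp [mul_add, add_mul, mul_assoc, star_unitaryCol_mul_assoc, hu2, ht2, hW']
  · rw [extSum_apply, extSum_apply, hu', ht']
    simp only [map_add, map_mul, map_star, star_add, star_mul, star_star, mul_add, add_mul,
      mul_assoc, calkinMk_star_unitaryCol_mul_assoc]
    simp [mul_assoc, calkinMk_star_unitaryCol_mul_assoc]

variable (A H)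

/-- Unitary equivalence of extensions as a setoid. -/
def extSetoid : Setoid (UnitalExtension A H) where
  r := ExtEquivalent
  iseqv :=
    { refl := fun ρ => ⟨1, one_mem _, fun a => by simp⟩
      symm := by
        rintro ρ σ ⟨U, hU, h⟩
        refine ⟨star U, Unitary.star_mem hU, fun a => ?_⟩
        have h1 : star (calkinMk H U) * calkinMk H U = 1 := by
          rw [← map_star, ← map_mul, (Unitary.mem_iff.1 hU).1, map_one]
        rw [h, map_star, star_star]
        calc ρ.1 a = 1 * ρ.1 a * 1 := by simp
          _ = _ := by rw [← h1]; simp only [mul_assoc]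
      trans := by
        rintro ρ σ τ ⟨U, hU, h⟩ ⟨T, hT, h'⟩
        exact ⟨T * U, mul_mem hT hU, fun a => by simp [h, h', mul_assoc]⟩ }

/-- `Ext(A)`: the unitary equivalence classes of unital extensions of `A`. -/
def CStarExt : Type _ := Quotient (extSetoid A H)

variable {A H}

/-- The addition of `Ext(A)`, induced by the direct sum of extensions. By `CStarExt.add_eq` it does
not depend on the unitary `W : H ⊕ H → H` it is formed with. -/
def CStarExt.add (W : HilbertPow H 2 ≃ₗᵢ[ℂ] H) : CStarExt A H → CStarExt A H → CStarExt A H :=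
  Quotient.map₂ (sa := extSetoid A H) (sb := extSetoid A H) (sc := extSetoid A H) (extSum W)
    fun _ _ h _ _ h' => extSum_equivalent W W h h'

theorem CStarExt.add_eq (W W' : HilbertPow H 2 ≃ₗᵢ[ℂ] H) :
    (CStarExt.add W : CStarExt A H → CStarExt A H → CStarExt A H) = CStarExt.add W' := by
  funext x y
  induction x, y using Quotient.inductionOn₂ with
  | h ρ σ =>
    exact Quotient.sound (s := extSetoid A H) (extSum_equivalent W W'
      ((extSetoid A H).refl ρ) ((extSetoid A H).refl σ))

variable (A H)

/-- `Ext(A)` is a group under addition. -/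
def CStarExt.IsGroup : Prop :=
  ∃ (W : HilbertPow H 2 ≃ₗᵢ[ℂ] H) (g : AddGroup (CStarExt A H)),
    ∀ x y : CStarExt A H, g.add x y = CStarExt.add W x y

end Ext

end

noncomputable section

/-! ### Positive matrices over a C⋆-algebra. -/

section MatrixPositivity

/-! Replace the generators of `A` by positive invertible elements, scale them to `v₁, …, vₙ` with `∑
vᵢ² ≤ 1`, and add `v₀ = (1 - ∑ vᵢ²)^{1/2}`. In `M_{n+1}(A)` put `d = diag(0, 1, …, n)` and `p = (vᵢ
vⱼ)`. Since `∑ vᵢ² = 1`, `p` is a projection. The system is `S = span {1, d, d², p}`, in which `d`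
and `p` are self-adjoint elements whose squares also lie in `S`.

Let `θ` be the conjugate of `ρ ⊗ id` by `V`, and suppose that it had a ucp lift `ψ` on `S`. By
Arveson and Stinespring (`IsUCP.exists_dilation`), `ψ` is the restriction of a compression `x ↦ W*
σ(x) W` of a representation of the whole matrix algebra. For self-adjoint `x` with `x, x² ∈ S`, the
defect `D = (1 - WW*) σ(x) W` satisfies `D*D = W* σ(x²) W - (W* σ(x) W)²`, which lifts `θ(x²) -
θ(x)² = 0`. So `D` is compact, and `x` lies in the multiplicative domain modulo the compacts
(`mem_liftDomain_of_isSelfAdjoint`). That domain, cut down to where the compression lifts `θ`, is a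
closed `*`-subalgebra (`liftDomain`, `isClosed_liftDomain`).

It contains `d` and `p`, and these produce a full corner (`CStarMatrix.unit_mem_of_closed`):
polynomials in `d` give the `eᵢᵢ`; the products `eᵢᵢ p eₖₖ` give `vᵢvₖ ⊗ eᵢₖ`; square roots and
inverses give `vᵢ ⊗ eᵢᵢ` and `eᵢₖ` for nonzero indices; moving all generators into one corner gives
every `a ⊗ eⱼⱼ`. Compressing further by the column `Vⱼ` yields a ucp lift of `ρ` itself
(`hasUCPLift_of_unit_mem_liftDomain`), a contradiction. -/

theorem CStarMatrix.ofMatrix_apply_apply {m n B : Type*} (f : m → n → B) (i : m) (j : n) :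
    (CStarMatrix.ofMatrix f : CStarMatrix m n B) i j = f i j := rfl

theorem exists_star_mul_self_eq {C : Type*} [CStarAlgebra C] [PartialOrder C] [StarOrderedRing C]
    {a : C} (ha : 0 ≤ a) : ∃ b, a = star b * b :=
  CStarAlgebra.nonneg_iff_eq_star_mul_self.1 ha

variable {B : Type*} [CStarAlgebra B] [PartialOrder B] [StarOrderedRing B]
  {ι : Type*} [Fintype ι] [DecidableEq ι]

theorem CStarMatrix.star_mul_nonneg (y : ι → B) :
    0 ≤ (CStarMatrix.ofMatrix fun i j => star (y i) * y j : CStarMatrix ι ι B) := by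
  cases isEmpty_or_nonempty ι with
  | inl h =>
    refine le_of_eq ?_
    ext i
    exact h.elim i
  | inr h =>
    obtain ⟨k⟩ := h
    -- The only nonzero row of `R` is `y`, placed at an arbitrary index `k`; then `R* R = (yᵢ* yⱼ)`.
    let R : CStarMatrix ι ι B := CStarMatrix.ofMatrix fun l i => if l = k then y i else 0
    have hR : (CStarMatrix.ofMatrix fun i j => star (y i) * y j : CStarMatrix ι ι B)
        = star R * R := by
      ext i j
      rw [CStarMatrix.mul_apply, Finset.sum_eq_single k] <;>
        simp +contextual [R, CStarMatrix.star_apply, CStarMatrix.ofMatrix_apply_apply]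
    rw [hR]
    exact star_mul_self_nonneg R

theorem CStarMatrix.exists_eq_sum_star_mul {M : CStarMatrix ι ι B} (hM : 0 ≤ M) :
    ∃ N : CStarMatrix ι ι B, ∀ i j, M i j = ∑ k, star (N k i) * N k j := by
  obtain ⟨N, rfl⟩ := exists_star_mul_self_eq hM
  exact ⟨N, fun i j => by simp [CStarMatrix.mul_apply, CStarMatrix.star_apply]⟩

end MatrixPositivity

/-! ### Quadratic forms of ucp maps on operator systems. -/

section Quadratic

open scoped ComplexOrder

variable {B : Type*} [CStarAlgebra B] [PartialOrder B] [StarOrderedRing B]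
  {H : Type*} [NormedAddCommGroup H] [InnerProductSpace ℂ H] [CompleteSpace H]

theorem CStarMatrix.sum_inner_nonneg {k : ℕ} {T : CStarMatrix (Fin k) (Fin k) (H →L[ℂ] H)}
    (hT : 0 ≤ T) (ξ : Fin k → H) : 0 ≤ ∑ i, ∑ j, ⟪ξ i, T i j (ξ j)⟫_ℂ := by
  obtain ⟨N, hN⟩ := CStarMatrix.exists_eq_sum_star_mul hT
  have h : ∑ i, ∑ j, ⟪ξ i, T i j (ξ j)⟫_ℂ
      = ∑ l, ⟪∑ i, N l i (ξ i), ∑ j, N l j (ξ j)⟫_ℂ := by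
    simp only [hN, sum_apply, mul_apply_eq_comp, ContinuousLinearMap.star_eq_adjoint, inner_sum,
      ContinuousLinearMap.adjoint_inner_right, sum_inner]
    rw [Finset.sum_comm' (t' := Finset.univ) (s' := fun _ => Finset.univ) (by simp)]
    rw [Finset.sum_congr rfl fun _ _ => Finset.sum_comm, Finset.sum_comm]
  rw [h]
  refine Finset.sum_nonneg fun l _ => ?_
  rw [inner_self_eq_norm_sq_to_K]
  exact (Complex.zero_le_real.2 (sq_nonneg ‖∑ i, N l i (ξ i)‖)).trans_eq (by simp)

variable {S : OperatorSubsystem B} {ψ : S.toSubmodule →ₗ[ℂ] (H →L[ℂ] H)}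

/-- The adjoint of a matrix over an operator subsystem. -/
def OperatorSubsystem.matrixStar (S : OperatorSubsystem B) {k : ℕ}
    (M : CStarMatrix (Fin k) (Fin k) S.toSubmodule) :
    CStarMatrix (Fin k) (Fin k) S.toSubmodule :=
  CStarMatrix.ofMatrix fun i j => ⟨star (M j i : B), S.star_mem' (M j i).2⟩

/-- The quadratic form of the entrywise application of `ψ` to a matrix, as a linear function of
the matrix. -/
def quadraticForm (ψ : S.toSubmodule →ₗ[ℂ] (H →L[ℂ] H)) {k : ℕ} (ξ : Fin k → H) :
    CStarMatrix (Fin k) (Fin k) S.toSubmodule →ₗ[ℂ] ℂ where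
  toFun M := ∑ i, ∑ j, ⟪ξ i, ψ (M i j) (ξ j)⟫_ℂ
  map_add' M N := by simp [Finset.sum_add_distrib]
  map_smul' c M := by simp [Finset.mul_sum]

theorem IsUCP.quadraticForm_nonneg (h : IsUCP S ψ) {k : ℕ} (ξ : Fin k → H)
    {M : CStarMatrix (Fin k) (Fin k) S.toSubmodule} (hM : 0 ≤ M.map fun s => (s : B)) :
    0 ≤ quadraticForm ψ ξ M :=
  CStarMatrix.sum_inner_nonneg (h.map_nonneg k M hM) ξ

/-- Adding `‖M‖ · 1` makes a self-adjoint `M` positive without leaving the matrices over `S`, and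
the form of the identity matrix is `∑ ‖ξᵢ‖²`, which is real. -/
theorem IsUCP.quadraticForm_im (h : IsUCP S ψ) {k : ℕ} (ξ : Fin k → H)
    {M : CStarMatrix (Fin k) (Fin k) S.toSubmodule}
    (hM : IsSelfAdjoint (M.map fun s => (s : B))) : (quadraticForm ψ ξ M).im = 0 := by
  let I : CStarMatrix (Fin k) (Fin k) S.toSubmodule :=
    CStarMatrix.ofMatrix fun i j => if i = j then ⟨1, S.one_mem'⟩ else 0
  have hI : I.map (fun s => (s : B)) = 1 := by
    ext i j
    by_cases hij : i = j <;>
      simp [I, CStarMatrix.one_apply, CStarMatrix.ofMatrix_apply_apply, hij]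
  let c : ℝ := ‖M.map fun s => (s : B)‖
  have h1 : 0 ≤ (M + (c : ℂ) • I).map fun s => (s : B) := by
    have h2 : (M + (c : ℂ) • I).map (fun s => (s : B))
        = M.map (fun s => (s : B)) + algebraMap ℝ _ c := by
      have h3 : (M + (c : ℂ) • I).map (fun s => (s : B))
          = M.map (fun s => (s : B)) + (c : ℂ) • I.map (fun s => (s : B)) := rfl
      rw [h3, hI, Algebra.algebraMap_eq_smul_one, Complex.coe_smul]
      rfl
    rw [h2]
    have := IsSelfAdjoint.neg_algebraMap_norm_le_self (a := M.map fun s => (s : B)) hM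
    exact neg_le_iff_add_nonneg.1 this
  have h4 : (quadraticForm ψ ξ I).im = 0 := by
    have h5 : quadraticForm ψ ξ I = ∑ i, ⟪ξ i, ξ i⟫_ℂ := by
      change ∑ i, ∑ j, ⟪ξ i, ψ (if i = j then ⟨1, S.one_mem'⟩ else 0) (ξ j)⟫_ℂ = _
      refine Finset.sum_congr rfl fun i _ => ?_
      rw [Finset.sum_eq_single i]
      · simp [h.map_one]
      · intro j _ hj
        simp [hj.symm]
      · simp
    rw [h5, Complex.im_sum]
    exact Finset.sum_eq_zero fun i _ => inner_self_im (𝕜 := ℂ) (ξ i)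
  have h6 := (Complex.nonneg_iff.1 (h.quadraticForm_nonneg ξ h1)).2
  simpa [h4] using h6.symm

/-- Write `2M = P - iR` with `P = M + M*` positive and `R = i(M - M*)` self-adjoint: `R` has a real
form, so `iR` contributes nothing to the real part. This is the positivity needed for the Riesz
extension. -/
theorem IsUCP.quadraticForm_re_nonneg (h : IsUCP S ψ) {k : ℕ} (ξ : Fin k → H)
    {M : CStarMatrix (Fin k) (Fin k) S.toSubmodule}
    (hM : 0 ≤ (M.map fun s => (s : B)) + star (M.map fun s => (s : B))) :
    0 ≤ (quadraticForm ψ ξ M).re := by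
  let P := M + S.matrixStar M
  let R := Complex.I • (M - S.matrixStar M)
  have hP : P.map (fun s => (s : B)) = (M.map fun s => (s : B)) + star (M.map fun s => (s : B)) :=
    rfl
  have hR : R.map (fun s => (s : B)) =
      Complex.I • ((M.map fun s => (s : B)) - star (M.map fun s => (s : B))) :=
    rfl
  have h1 := (Complex.nonneg_iff.1 (h.quadraticForm_nonneg ξ (hP ▸ hM))).1
  have h2 : (quadraticForm ψ ξ R).im = 0 := by
    refine h.quadraticForm_im ξ ?_
    rw [hR, isSelfAdjoint_iff]
    simp only [star_smul, star_sub, star_star, RCLike.star_def, Complex.conj_I]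
    rw [neg_smul, ← smul_neg, neg_sub]
  have h3 : (2 : ℂ) • M = P - Complex.I • R := by
    simp only [P, R, smul_smul, Complex.I_mul_I, neg_smul, one_smul, two_smul]
    abel
  have h4 := congrArg Complex.re (congrArg (quadraticForm ψ ξ) h3)
  simp only [map_smul, map_sub, smul_eq_mul] at h4
  simp [h2] at h4
  linarith

end Quadratic

/-! ### Completely positive functionals on finitely supported matrices. -/

section Functional

open scoped ComplexOrder ComplexConjugate

variable {ι B : Type*} [CStarAlgebra B]

/-- The finitely supported matrix `(yᵢ* zⱼ)ᵢⱼ`. -/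
def Finsupp.starMul (y z : ι →₀ B) : ι × ι →₀ B := by
  classical
  exact Finsupp.onFinset (y.support ×ˢ z.support) (fun p => star (y p.1) * z p.2) fun p hp => by
    simp only [Finset.mem_product, Finsupp.mem_support_iff]
    exact ⟨fun h => hp (by simp [h]), fun h => hp (by simp [h])⟩

@[simp]
theorem Finsupp.starMul_apply (y z : ι →₀ B) (p : ι × ι) :
    Finsupp.starMul y z p = star (y p.1) * z p.2 := rfl

theorem Finsupp.starMul_single (i j : ι) (a b : B) :
    Finsupp.starMul (Finsupp.single i a) (Finsupp.single j b) =
      Finsupp.single (i, j) (star a * b) := by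
  classical
  ext ⟨k, l⟩
  by_cases hk : i = k <;> by_cases hl : j = l <;> simp [hk, hl]

variable (ι B) in
/-- A completely positive functional on the finitely supported matrices over `B`. -/
structure CPFunctional where
  /-- The underlying linear functional. -/
  toLinearMap : (ι × ι →₀ B) →ₗ[ℂ] ℂ
  conj_starMul : ∀ y z, conj (toLinearMap (Finsupp.starMul z y)) =
    toLinearMap (Finsupp.starMul y z)
  starMul_self_nonneg : ∀ y, 0 ≤ (toLinearMap (Finsupp.starMul y y)).re

end Functional

/-! ### The cone of matrices with positive real part. -/

section Extension

open scoped ComplexOrder ComplexConjugate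

variable {B : Type*} [CStarAlgebra B] [PartialOrder B] [StarOrderedRing B]

/-- The submatrix `(f (gᵢ, gⱼ))ᵢⱼ` of a finitely supported matrix. -/
def Finsupp.cstarSubmatrix {ι : Type*} {k : ℕ} (g : Fin k → ι) :
    (ι × ι →₀ B) →ₗ[ℂ] CStarMatrix (Fin k) (Fin k) B where
  toFun f := CStarMatrix.ofMatrix fun i j => f (g i, g j)
  map_add' _ _ := rfl
  map_smul' _ _ := rfl

/-- The cone of the finitely supported matrices with positive real part. -/
def Finsupp.accretiveCone (ι B : Type*) [CStarAlgebra B] [PartialOrder B] [StarOrderedRing B] :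
    PointedCone ℝ (ι × ι →₀ B) where
  carrier := {f | ∀ (k : ℕ) (g : Fin k → ι),
    0 ≤ Finsupp.cstarSubmatrix g f + star (Finsupp.cstarSubmatrix g f)}
  add_mem' {a b} ha hb k g := by
    have := add_nonneg (ha k g) (hb k g)
    rw [map_add, star_add]
    convert this using 1
    abel
  zero_mem' k g := by simp
  smul_mem' c f hf k g := by
    have h1 : Finsupp.cstarSubmatrix g (c • f) = (c : ℝ) • Finsupp.cstarSubmatrix g f := rfl
    rw [h1, star_smul, star_trivial, ← smul_add]
    exact smul_nonneg c.2 (hf k g)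

/-- It suffices to check membership in the cone on one submatrix containing the support. -/
theorem Finsupp.mem_accretiveCone_of_support {ι : Type*} {f : ι × ι →₀ B} {k : ℕ} {g : Fin k → ι}
    (hg : Function.Injective g) (hf : ∀ i j, f (i, j) ≠ 0 → i ∈ Set.range g ∧ j ∈ Set.range g)
    (h : 0 ≤ Finsupp.cstarSubmatrix g f + star (Finsupp.cstarSubmatrix g f)) :
    f ∈ Finsupp.accretiveCone ι B := by
  classical
  obtain ⟨N, hN⟩ := CStarMatrix.exists_eq_sum_star_mul h
  -- The rows of `N`, extended by zero off the range of `g`. They express `f + f*` as `∑ yₗ* yₗ` on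
  -- the full index set, so every other submatrix is positive too.
  let y (l : Fin k) (i : ι) : B := if hi : ∃ i', g i' = i then N l hi.choose else 0
  have hy (l i') : y l (g i') = N l i' := by
    have hi : ∃ i'', g i'' = g i' := ⟨i', rfl⟩
    simp only [y, dif_pos hi]
    rw [hg hi.choose_spec]
  have hy0 (l) {i} (hi : i ∉ Set.range g) : y l i = 0 := dif_neg hi
  have key (i j : ι) : f (i, j) + star (f (j, i)) = ∑ l, star (y l i) * y l j := by
    by_cases hij : i ∈ Set.range g ∧ j ∈ Set.range g
    · obtain ⟨⟨i, rfl⟩, ⟨j, rfl⟩⟩ := hij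
      simp only [hy]
      exact hN i j
    · have h1 : f (i, j) = 0 := by
        by_contra h0
        exact hij (hf i j h0)
      have h2 : f (j, i) = 0 := by
        by_contra h0
        exact hij (hf j i h0).symm
      rw [h1, h2, star_zero, add_zero, eq_comm]
      refine Finset.sum_eq_zero fun l _ => ?_
      rcases not_and_or.1 hij with hi | hj
      · rw [hy0 l hi, star_zero, zero_mul]
      · rw [hy0 l hj, mul_zero]
  intro k' g'
  have h3 : Finsupp.cstarSubmatrix g' f + star (Finsupp.cstarSubmatrix g' f) =
      ∑ l, CStarMatrix.ofMatrix fun i j => star (y l (g' i)) * y l (g' j) := by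
    ext i j
    refine (key (g' i) (g' j)).trans ?_
    have := map_sum (CStarMatrix.ofMatrixₗ (m := Fin k') (n := Fin k') (A := B) (R := ℂ)
      : Matrix (Fin k') (Fin k') B ≃ₗ[ℂ] CStarMatrix (Fin k') (Fin k') B)
      (fun l : Fin k => fun i j => star (y l (g' i)) * y l (g' j)) Finset.univ
    refine .trans ?_ (congrFun (congrFun this i) j)
    exact (Matrix.sum_apply i j Finset.univ
      (fun l : Fin k => (fun i j => star (y l (g' i)) * y l (g' j) : Matrix _ _ B))).symm
  rw [h3]
  exact Finset.sum_nonneg fun l _ => CStarMatrix.star_mul_nonneg _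

theorem Finsupp.exists_injective_fin {ι M : Type*} [Zero M] (f : ι × ι →₀ M) :
    ∃ (k : ℕ) (g : Fin k → ι), Function.Injective g ∧
      ∀ i j, f (i, j) ≠ 0 → i ∈ Set.range g ∧ j ∈ Set.range g := by
  classical
  let t : Finset ι := f.support.image Prod.fst ∪ f.support.image Prod.snd
  refine ⟨t.card, fun i => t.equivFin.symm i,
    Subtype.val_injective.comp t.equivFin.symm.injective, fun i j hij => ?_⟩
  have hr : Set.range (fun i => (t.equivFin.symm i : ι)) = t := by
    ext x
    refine ⟨?_, fun hx => ⟨t.equivFin ⟨x, hx⟩, by simp⟩⟩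
    rintro ⟨i, rfl⟩
    exact (t.equivFin.symm i).2
  rw [hr]
  have hs : (i, j) ∈ f.support := Finsupp.mem_support_iff.2 hij
  exact ⟨Finset.mem_union_left _ (Finset.mem_image_of_mem Prod.fst hs),
    Finset.mem_union_right _ (Finset.mem_image_of_mem Prod.snd hs)⟩

/-- The cofinality hypothesis of the Riesz extension theorem. The correction is the scalar `‖f +
f*‖` on the diagonal over the support of `f`; having scalar entries, it lies in the matrices over
any operator subsystem. -/
theorem Finsupp.exists_add_mem_accretiveCone {ι : Type*} (f : ι × ι →₀ B) :
    ∃ (x : ι × ι →₀ B), (∀ p, ∃ c : ℂ, x p = c • 1) ∧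
      x + f ∈ Finsupp.accretiveCone ι B := by
  classical
  obtain ⟨k, g, hg, hf⟩ := f.exists_injective_fin
  let c : ℝ := ‖Finsupp.cstarSubmatrix g f + star (Finsupp.cstarSubmatrix g f)‖
  let x : ι × ι →₀ B := ∑ i, Finsupp.single (g i, g i) ((c : ℂ) • 1)
  have hx (i j) : x (i, j) = if i = j ∧ i ∈ Set.range g then (c : ℂ) • 1 else 0 := by
    simp only [x, Finsupp.finsetSum_apply, Finsupp.single_apply, Prod.mk.injEq]
    split_ifs with h
    · obtain ⟨rfl, ⟨l, rfl⟩⟩ := h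
      rw [Finset.sum_eq_single l] <;> simp +contextual [hg.eq_iff]
    · refine Finset.sum_eq_zero fun l _ => if_neg ?_
      rintro ⟨rfl, rfl⟩
      exact h ⟨rfl, l, rfl⟩
  have hxm : Finsupp.cstarSubmatrix g x = algebraMap ℝ _ c := by
    ext i j
    refine (hx _ _).trans ?_
    rw [CStarMatrix.algebraMap_apply]
    by_cases hij : i = j
    · simp [hij, Algebra.algebraMap_eq_smul_one]
    · simp [hij, hg.eq_iff]
  refine ⟨x, ?_, Finsupp.mem_accretiveCone_of_support hg ?_ ?_⟩
  · rintro ⟨i, j⟩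
    rw [hx]
    split_ifs
    exacts [⟨c, rfl⟩, ⟨0, (zero_smul _ _).symm⟩]
  · intro i j hij
    rw [Finsupp.add_apply, hx] at hij
    split_ifs at hij with h
    · exact ⟨h.2, h.1 ▸ h.2⟩
    · exact hf i j (by simpa using hij)
  · have hs : IsSelfAdjoint (Finsupp.cstarSubmatrix g f + star (Finsupp.cstarSubmatrix g f)) :=
      IsSelfAdjoint.add_star_self _
    have h1 := neg_le_iff_add_nonneg.1 hs.neg_algebraMap_norm_le_self
    have h2 : (0 : CStarMatrix (Fin k) (Fin k) B) ≤ algebraMap ℝ _ c :=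
      algebraMap_nonneg _ (norm_nonneg _)
    have h3 : star (algebraMap ℝ (CStarMatrix (Fin k) (Fin k) B) c) = algebraMap ℝ _ c :=
      (IsSelfAdjoint.of_nonneg h2)
    rw [map_add, hxm, star_add, h3]
    refine (add_nonneg h1 h2).trans_eq ?_
    have h4 {G : Type _} [AddCommGroup G] (u v w : G) : u + v + w + w = w + u + (w + v) := by abel
    exact h4 _ _ _

end Extension

/-! ### Arveson's extension theorem through the Riesz extension theorem. -/

section Extension

open scoped ComplexOrder ComplexConjugate

variable {B : Type*} [CStarAlgebra B] [PartialOrder B] [StarOrderedRing B]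

theorem Finsupp.starMul_self_mem_accretiveCone {ι : Type*} (y : ι →₀ B) :
    Finsupp.starMul y y ∈ Finsupp.accretiveCone ι B := by
  intro k g
  have h : 0 ≤ Finsupp.cstarSubmatrix g (Finsupp.starMul y y) :=
    CStarMatrix.star_mul_nonneg fun i => y (g i)
  exact add_nonneg h (star_nonneg_iff.2 h)

/-- Skew-adjoint matrices have real part zero, so they and their negatives lie in the cone. A real
functional nonnegative on the cone therefore vanishes on them, that is, it takes equal values at `f`
and `f*`. -/
theorem Finsupp.mem_accretiveCone_of_antisymm {ι : Type*} {f : ι × ι →₀ B}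
    (hf : ∀ i j, f (i, j) = - star (f (j, i))) : f ∈ Finsupp.accretiveCone ι B := by
  intro k g
  refine le_of_eq ?_
  ext i j
  change 0 = f (g i, g j) + star (f (g j, g i))
  rw [hf, neg_add_cancel]

/-- A real functional that is nonnegative on the cone of matrices with positive real part is the
real part of a completely positive functional. -/
theorem CPFunctional.exists_of_nonneg {ι : Type*} (g : (ι × ι →₀ B) →ₗ[ℝ] ℝ)
    (hg : ∀ f ∈ Finsupp.accretiveCone ι B, 0 ≤ g f) :
    ∃ Φ : CPFunctional ι B, ∀ f, Φ.toLinearMap f = g f - g (Complex.I • f) * Complex.I := by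
  have hstar {f f' : ι × ι →₀ B} (h : ∀ i j, f' (i, j) = star (f (j, i))) : g f' = g f := by
    have h1 := hg (f - f') (Finsupp.mem_accretiveCone_of_antisymm fun i j => by simp [h])
    have h2 := hg (f' - f) (Finsupp.mem_accretiveCone_of_antisymm fun i j => by simp [h])
    rw [map_sub] at h1 h2
    linarith
  let φ : (ι × ι →₀ B) →ₗ[ℂ] ℂ := Module.Dual.extendRCLike g
  have hφ (f) : φ f = g f - g (Complex.I • f) * Complex.I := by
    simp [φ, Module.Dual.extendRCLike_apply, mul_comm]
  refine ⟨⟨φ, fun y z => ?_, fun y => ?_⟩, hφ⟩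
  · have h1 : g (Finsupp.starMul y z) = g (Finsupp.starMul z y) :=
      hstar fun i j => by simp
    have h2 : g (Complex.I • Finsupp.starMul y z) = - g (Complex.I • Finsupp.starMul z y) := by
      rw [← map_neg]
      exact hstar fun i j => by simp
    rw [hφ, hφ, h1, h2]
    simp
  · have := hg _ (Finsupp.starMul_self_mem_accretiveCone y)
    simpa [hφ] using this

variable {H : Type*} [NormedAddCommGroup H] [InnerProductSpace ℂ H] [CompleteSpace H]
  {S : OperatorSubsystem B} {ψ : S.toSubmodule →ₗ[ℂ] (H →L[ℂ] H)}

/-- The form of **Arveson's extension theorem** used here: the functional on finitely supported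
matrices over `S` that describes `ψ` extends to a completely positive functional. -/
theorem IsUCP.exists_cpFunctional (h : IsUCP S ψ) :
    ∃ Φ : CPFunctional H B, ∀ (ξ η : H) (s : S.toSubmodule),
      Φ.toLinearMap (Finsupp.single (ξ, η) (s : B)) = ⟪ξ, ψ s η⟫_ℂ := by
  classical
  -- An arbitrary linear extension, with no positivity: it only makes `L` defined everywhere, and
  -- `L` is then used on matrices over `S` alone.
  obtain ⟨ψ', hψ'⟩ := LinearMap.exists_extend ψ
  have hψ's (s : S.toSubmodule) : ψ' s = ψ s := congrArg (· s) hψ'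
  let l (p : H × H) : B →ₗ[ℂ] ℂ :=
    { toFun := fun b => ⟪p.1, ψ' b p.2⟫_ℂ
      map_add' := fun a b => by simp
      map_smul' := fun c a => by simp }
  let L : (H × H →₀ B) →ₗ[ℂ] ℂ := Finsupp.lsum ℂ l
  have hLs (ξ η : H) (b : B) : L (Finsupp.single (ξ, η) b) = ⟪ξ, ψ' b η⟫_ℂ := by
    simp [L, l]
  have hL {f : H × H →₀ B} {k : ℕ} {g : Fin k → H} (hg : Function.Injective g)
      (hf : ∀ i j, f (i, j) ≠ 0 → i ∈ Set.range g ∧ j ∈ Set.range g) :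
      L f = ∑ i, ∑ j, ⟪g i, ψ' (f (g i, g j)) (g j)⟫_ℂ := by
    have h1 : f = ∑ i, ∑ j, Finsupp.single (g i, g j) (f (g i, g j)) := by
      ext ⟨x, y⟩
      simp only [Finsupp.finsetSum_apply, Finsupp.single_apply, Prod.mk.injEq]
      by_cases hxy : x ∈ Set.range g ∧ y ∈ Set.range g
      · obtain ⟨⟨i, rfl⟩, ⟨j, rfl⟩⟩ := hxy
        rw [Finset.sum_eq_single i, Finset.sum_eq_single j] <;> simp +contextual [hg.eq_iff]
      · have h2 : f (x, y) = 0 := by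
          by_contra h0
          exact hxy (hf x y h0)
        rw [h2, eq_comm]
        refine Finset.sum_eq_zero fun i _ => Finset.sum_eq_zero fun j _ => if_neg ?_
        rintro ⟨rfl, rfl⟩
        exact hxy ⟨⟨i, rfl⟩, ⟨j, rfl⟩⟩
    conv_lhs => rw [h1]
    simp only [map_sum, hLs]
  let D : Submodule ℝ (H × H →₀ B) :=
    { carrier := {f | ∀ p, f p ∈ S.toSubmodule}
      add_mem' := fun ha hb p => S.toSubmodule.add_mem (ha p) (hb p)
      zero_mem' := fun p => S.toSubmodule.zero_mem
      smul_mem' := fun c f hf p => S.toSubmodule.smul_mem (c : ℂ) (hf p) }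
  let Lr : (H × H →₀ B) →ₗ[ℝ] ℝ := Complex.reLm.comp (L.restrictScalars ℝ)
  -- Extend `Re L` from the matrices over `S` to all matrices, keeping it nonnegative on the cone.
  -- The two side goals are positivity on the subspace and cofinality.
  obtain ⟨g, hgD, hg⟩ := riesz_extension (Finsupp.accretiveCone H B) ⟨D, Lr.domRestrict D⟩
    (by
      rintro ⟨f, hfD⟩ hf
      obtain ⟨k, g, hg, hfg⟩ := f.exists_injective_fin
      change 0 ≤ (L f).re
      rw [hL hg hfg]
      let M : CStarMatrix (Fin k) (Fin k) S.toSubmodule :=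
        CStarMatrix.ofMatrix fun i j => ⟨f (g i, g j), hfD _⟩
      have h1 := h.quadraticForm_re_nonneg g (M := M) (hf k g)
      convert h1 using 3
      refine Finset.sum_congr rfl fun i _ => Finset.sum_congr rfl fun j _ => ?_
      rw [← hψ's]
      rfl)
    (fun f => by
      obtain ⟨x, hx, hxf⟩ := f.exists_add_mem_accretiveCone
      refine ⟨⟨x, fun p => ?_⟩, hxf⟩
      obtain ⟨c, hc⟩ := hx p
      rw [hc]
      exact S.toSubmodule.smul_mem c S.one_mem')
  obtain ⟨Φ, hΦ⟩ := CPFunctional.exists_of_nonneg g hg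
  refine ⟨Φ, fun ξ η s => ?_⟩
  have hgL (s : S.toSubmodule) : g (Finsupp.single (ξ, η) (s : B)) = (⟪ξ, ψ s η⟫_ℂ).re := by
    have hs : Finsupp.single (ξ, η) (s : B) ∈ D := by
      intro p
      rw [Finsupp.single_apply]
      split_ifs
      exacts [s.2, S.toSubmodule.zero_mem]
    refine (hgD ⟨_, hs⟩).trans ?_
    change (L (Finsupp.single (ξ, η) (s : B))).re = _
    rw [hLs, hψ's]
  rw [hΦ, Finsupp.smul_single, hgL s]
  -- The imaginary part of the inner product is read off from the real functional at `i s`.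
  have h2 := hgL (Complex.I • s)
  rw [Submodule.coe_smul] at h2
  rw [h2, map_smul, smul_apply, inner_smul_right]
  apply Complex.ext <;> simp

end Extension

/-! ### Stinespring's construction. -/

section Stinespring

open scoped ComplexOrder ComplexConjugate
open UniformSpace Completion

variable {ι B : Type*} [CStarAlgebra B]

/-- The pre-Hilbert space of the finitely supported vectors over `B`, with the inner product
defined by a completely positive functional. -/
@[nolint unusedArguments]
def CPFunctional.PreSpace (_ : CPFunctional ι B) : Type _ := ι →₀ B

namespace CPFunctional

variable (Φ : CPFunctional ι B)

instance : AddCommGroup Φ.PreSpace := inferInstanceAs (AddCommGroup (ι →₀ B))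
instance : Module ℂ Φ.PreSpace := inferInstanceAs (Module ℂ (ι →₀ B))

/-- A finitely supported vector as an element of the pre-Hilbert space. -/
def toPre : (ι →₀ B) ≃ₗ[ℂ] Φ.PreSpace := LinearEquiv.refl ℂ _

/-- The semi-inner product defined by a completely positive functional. -/
abbrev preCore : PreInnerProductSpace.Core ℂ Φ.PreSpace where
  inner y z := Φ.toLinearMap (Finsupp.starMul (Φ.toPre.symm y) (Φ.toPre.symm z))
  conj_inner_symm y z := Φ.conj_starMul _ _
  re_inner_nonneg y := Φ.starMul_self_nonneg _
  add_left x y z := by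
    rw [← map_add]
    congr 1
    ext p
    simp [add_mul]
  smul_left x y c := by
    rw [← smul_eq_mul, ← map_smul]
    congr 1
    ext p
    simp

instance : SeminormedAddCommGroup Φ.PreSpace :=
  InnerProductSpace.Core.toSeminormedAddCommGroup (c := Φ.preCore)
instance : InnerProductSpace ℂ Φ.PreSpace :=
  InnerProductSpace.ofCore Φ.preCore

theorem preSpace_inner (y z : ι →₀ B) :
    ⟪Φ.toPre y, Φ.toPre z⟫_ℂ = Φ.toLinearMap (Finsupp.starMul y z) := rfl

/-- The Stinespring space of a completely positive functional. -/
abbrev Space : Type _ := UniformSpace.Completion Φ.PreSpace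

/-- Left multiplication of a finitely supported vector by `a`. -/
def leftMul (a : B) : Φ.PreSpace →ₗ[ℂ] Φ.PreSpace :=
  Φ.toPre.toLinearMap ∘ₗ Finsupp.mapRange.linearMap (LinearMap.mulLeft ℂ a) ∘ₗ
    Φ.toPre.symm.toLinearMap

theorem leftMul_toPre (a : B) (y : ι →₀ B) : Φ.leftMul a (Φ.toPre y) =
    Φ.toPre (Finsupp.mapRange.linearMap (LinearMap.mulLeft ℂ a) y) := rfl

theorem leftMul_one : Φ.leftMul 1 = LinearMap.id := by
  ext1 y
  refine Finsupp.ext fun i => one_mul _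

theorem leftMul_mul (a b : B) : Φ.leftMul (a * b) = Φ.leftMul a ∘ₗ Φ.leftMul b := by
  ext1 y
  refine Finsupp.ext fun i => mul_assoc _ _ _

theorem leftMul_add (a b : B) : Φ.leftMul (a + b) = Φ.leftMul a + Φ.leftMul b := by
  ext1 y
  refine Finsupp.ext fun i => add_mul _ _ _

theorem leftMul_smul (c : ℂ) (a : B) : Φ.leftMul (c • a) = c • Φ.leftMul a := by
  ext1 y
  refine Finsupp.ext fun i => smul_mul_assoc _ _ _

theorem inner_leftMul (a : B) (y z : Φ.PreSpace) :
    ⟪Φ.leftMul (star a) y, z⟫_ℂ = ⟪y, Φ.leftMul a z⟫_ℂ := by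
  obtain ⟨y, rfl⟩ := Φ.toPre.surjective y
  obtain ⟨z, rfl⟩ := Φ.toPre.surjective z
  rw [leftMul_toPre, leftMul_toPre, preSpace_inner, preSpace_inner]
  congr 1
  ext p
  simp [mul_assoc]

theorem norm_leftMul_le (a : B) (y : Φ.PreSpace) : ‖Φ.leftMul a y‖ ≤ ‖a‖ * ‖y‖ := by
  let _ := CStarAlgebra.spectralOrder B
  have _ := CStarAlgebra.spectralOrderedRing B
  have h0 : 0 ≤ algebraMap ℝ B (‖a‖ ^ 2) - star a * a := by
    have := (IsSelfAdjoint.star_mul_self a).le_algebraMap_norm_self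
    rw [CStarRing.norm_star_mul_self, ← sq] at this
    exact sub_nonneg.2 this
  obtain ⟨b, hb⟩ := exists_star_mul_self_eq h0
  have h1 : ⟪Φ.leftMul a y, Φ.leftMul a y⟫_ℂ + ⟪Φ.leftMul b y, Φ.leftMul b y⟫_ℂ
      = (‖a‖ ^ 2 : ℝ) * ⟪y, y⟫_ℂ := by
    have h2 : star a * a + star b * b = ((‖a‖ ^ 2 : ℝ) : ℂ) • 1 := by
      rw [← hb, add_sub_cancel, Complex.coe_smul, Algebra.algebraMap_eq_smul_one]
    rw [← inner_leftMul, ← inner_leftMul, ← LinearMap.comp_apply, ← leftMul_mul,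
      ← LinearMap.comp_apply, ← leftMul_mul, ← inner_add_left, ← LinearMap.add_apply,
      ← leftMul_add, h2, leftMul_smul, leftMul_one, LinearMap.smul_apply, inner_smul_left,
      Complex.conj_ofReal, LinearMap.id_apply]
  simp only [inner_self_eq_norm_sq_to_K, Complex.coe_algebraMap] at h1
  have h3 : ‖Φ.leftMul a y‖ ^ 2 + ‖Φ.leftMul b y‖ ^ 2 = ‖a‖ ^ 2 * ‖y‖ ^ 2 := by exact_mod_cast h1
  rw [← sq_le_sq₀ (by positivity) (by positivity), mul_pow]
  linarith [sq_nonneg ‖Φ.leftMul b y‖]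

/-- The representation of `B` on the Stinespring space. -/
def rep : B →⋆ₐ[ℂ] (Φ.Space →L[ℂ] Φ.Space) where
  toFun a := ((Φ.leftMul a).mkContinuous ‖a‖ (Φ.norm_leftMul_le a)).completion
  map_one' := by
    ext x
    induction x using induction_on with
    | hp => apply isClosed_eq <;> fun_prop
    | ih x => simp [leftMul_one]
  map_mul' a b := by
    ext x
    induction x using induction_on with
    | hp => apply isClosed_eq <;> fun_prop
    | ih x => simp [leftMul_mul]
  map_zero' := by
    ext x
    induction x using induction_on with
    | hp => apply isClosed_eq <;> fun_prop
    | ih x => simp [show Φ.leftMul 0 = 0 by simpa using Φ.leftMul_smul 0 0, Completion.coe_zero]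
  map_add' a b := by
    ext x
    induction x using induction_on with
    | hp => apply isClosed_eq <;> fun_prop
    | ih x => simp [leftMul_add, Completion.coe_add]
  commutes' c := by
    ext x
    induction x using induction_on with
    | hp => apply isClosed_eq <;> fun_prop
    | ih x => simp [Algebra.algebraMap_eq_smul_one, leftMul_smul, leftMul_one]
  map_star' a := by
    refine (ContinuousLinearMap.eq_adjoint_iff _ _).2 fun x y => ?_
    induction x, y using induction_on₂ with
    | hp => apply isClosed_eq <;> fun_prop
    | ih x y => simp [inner_leftMul]

theorem rep_coe (a : B) (y : Φ.PreSpace) : Φ.rep a (y : Φ.Space) = (Φ.leftMul a y : Φ.Space) :=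
  ContinuousLinearMap.completion_apply_coe _ _

end CPFunctional

/-- A map between inner product spaces that preserves inner products is linear. -/
def linearIsometryOfInner {E F : Type*} [NormedAddCommGroup E] [InnerProductSpace ℂ E]
    [NormedAddCommGroup F] [InnerProductSpace ℂ F] (f : E → F)
    (hf : ∀ x y, ⟪f x, f y⟫_ℂ = ⟪x, y⟫_ℂ) : E →ₗᵢ[ℂ] F :=
  LinearMap.isometryOfInner
    { toFun := f
      map_add' := fun x y => by
        rw [← sub_eq_zero, ← inner_self_eq_zero (𝕜 := ℂ)]
        simp only [inner_sub_left, inner_sub_right, inner_add_left, inner_add_right, hf]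
        ring
      map_smul' := fun c x => by
        rw [← sub_eq_zero, ← inner_self_eq_zero (𝕜 := ℂ)]
        simp only [inner_sub_left, inner_sub_right, inner_smul_left, inner_smul_right, hf,
          RingHom.id_apply]
        ring } hf

variable [PartialOrder B] [StarOrderedRing B]
  {H : Type*} [NormedAddCommGroup H] [InnerProductSpace ℂ H] [CompleteSpace H]
  {S : OperatorSubsystem B} {ψ : S.toSubmodule →ₗ[ℂ] (H →L[ℂ] H)}

/-- **Arveson's extension theorem** combined with **Stinespring's dilation theorem**. -/
theorem IsUCP.exists_dilation (h : IsUCP S ψ) :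
    ∃ (Φ : CPFunctional H B) (W : H →ₗᵢ[ℂ] Φ.Space), ∀ s : S.toSubmodule,
      ψ s = W.toContinuousLinearMap.adjoint ∘L Φ.rep s ∘L W.toContinuousLinearMap := by
  obtain ⟨Φ, hΦ⟩ := h.exists_cpFunctional
  let v (ξ : H) : Φ.Space := (Φ.toPre (Finsupp.single ξ 1) : Φ.Space)
  have hv (ξ η : H) (s : S.toSubmodule) : ⟪v ξ, Φ.rep s (v η)⟫_ℂ = ⟪ξ, ψ s η⟫_ℂ := by
    rw [CPFunctional.rep_coe, Completion.inner_coe, CPFunctional.leftMul_toPre,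
      CPFunctional.preSpace_inner, Finsupp.mapRange.linearMap_apply, Finsupp.mapRange_single,
      Finsupp.starMul_single, ← hΦ]
    simp
  refine ⟨Φ, linearIsometryOfInner v fun ξ η => ?_, fun s => ?_⟩
  · have h1 := hv ξ η ⟨1, S.one_mem'⟩
    have h2 : Φ.rep ((⟨1, S.one_mem'⟩ : S.toSubmodule) : B) = 1 :=
      _root_.map_one Φ.rep
    rw [h.map_one, h2] at h1
    exact h1
  · ext1 η
    refine ext_inner_left ℂ fun ξ => ?_
    rw [ContinuousLinearMap.comp_apply, ContinuousLinearMap.adjoint_inner_right]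
    exact (hv ξ η s).symm

end Stinespring

section HilbertSpaces

open TopologicalSpace

variable {E F : Type*} [NormedAddCommGroup E] [InnerProductSpace ℂ E]
  [NormedAddCommGroup F] [InnerProductSpace ℂ F]

theorem Orthonormal.countable_of_separableSpace {ι : Type*} [SeparableSpace E] {v : ι → E}
    (hv : Orthonormal ℂ v) : Countable ι := by
  have hd : Pairwise fun i j => Disjoint (Metric.ball (v i) (1 / 2)) (Metric.ball (v j) (1 / 2)) := by
    intro i j hij
    refine Metric.ball_disjoint_ball ?_
    have h1 : ‖v i - v j‖ ^ 2 = 2 := by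
      rw [@norm_sub_sq ℂ, hv.1, hv.1, hv.2 hij]
      norm_num
    rw [dist_eq_norm]
    nlinarith [norm_nonneg (v i - v j)]
  refine Set.countable_univ_iff.1 (Set.PairwiseDisjoint.countable_of_isOpen
    (s := fun i => Metric.ball (v i) (1 / 2)) (fun i _ j _ hij => hd hij)
    (fun _ _ => Metric.isOpen_ball) fun i _ => ⟨v i, Metric.mem_ball_self (by norm_num)⟩)

theorem IsCompactOperator.exists_finiteDimensional {K : E →L[ℂ] F} (hK : IsCompactOperator K)
    {ε : ℝ} (hε : 0 < ε) : ∃ U : Submodule ℂ F, FiniteDimensional ℂ U ∧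
      ∀ x, ∀ u ∈ Uᗮ, ‖⟪u, K x⟫_ℂ‖ ≤ ε * ‖u‖ * ‖x‖ := by
  have h1 : TotallyBounded (K '' Metric.closedBall 0 1) :=
    (hK.isCompact_closure_image_closedBall (𝕜₁ := ℂ) (𝕜₂ := ℂ)
      (f := (K : E →ₗ[ℂ] F)) 1).totallyBounded.subset subset_closure
  obtain ⟨t, htf, hcov⟩ := Metric.totallyBounded_iff.1 h1 ε hε
  refine ⟨Submodule.span ℂ t, FiniteDimensional.span_of_finite ℂ htf, fun x u hu => ?_⟩
  rcases eq_or_ne x 0 with rfl | hx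
  · simp
  have hx' : 0 < ‖x‖ := norm_pos_iff.2 hx
  let z := ((‖x‖⁻¹ : ℝ) : ℂ) • x
  have hz : ‖z‖ = 1 := by
    simp only [z, norm_smul, Complex.norm_real, norm_inv, norm_norm]
    exact inv_mul_cancel₀ hx'.ne'
  obtain ⟨y, hy, hxy⟩ := Set.mem_iUnion₂.1 (hcov ⟨z, by simp [hz], rfl⟩)
  rw [Metric.mem_ball, dist_eq_norm] at hxy
  have h2 : ⟪u, K z⟫_ℂ = ⟪u, K z - y⟫_ℂ := by
    rw [inner_sub_right, Submodule.inner_left_of_mem_orthogonal (Submodule.subset_span hy) hu,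
      sub_zero]
  have h3 : ‖⟪u, K z⟫_ℂ‖ ≤ ‖u‖ * ε := by
    rw [h2]
    exact (norm_inner_le_norm _ _).trans (by gcongr)
  have h4 : ⟪u, K x⟫_ℂ = ‖x‖ * ⟪u, K z⟫_ℂ := by
    rw [← inner_smul_right, ← map_smul, smul_smul, ← Complex.ofReal_mul,
      mul_inv_cancel₀ hx'.ne', Complex.ofReal_one, one_smul]
  rw [h4, norm_mul, Complex.norm_real, norm_norm]
  nlinarith

variable [CompleteSpace E] [CompleteSpace F]

theorem exists_hilbertBasis_nat [SeparableSpace E] (hE : ¬ FiniteDimensional ℂ E) :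
    Nonempty (HilbertBasis ℕ ℂ E) := by
  obtain ⟨w, b, -⟩ := exists_hilbertBasis ℂ E
  have : Countable w := b.orthonormal.countable_of_separableSpace
  have : Infinite w := by
    by_contra hw
    rw [not_infinite_iff_finite] at hw
    have := Fintype.ofFinite w
    exact hE b.toOrthonormalBasis.toBasis.finiteDimensional_of_finite
  obtain ⟨e⟩ := nonempty_denumerable w
  let e : ℕ ≃ w := (Denumerable.eqv w).symm
  refine ⟨HilbertBasis.mk (v := b ∘ e) (b.orthonormal.comp _ e.injective) ?_⟩
  rw [e.surjective.range_comp]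
  exact b.dense_span.ge

theorem nonempty_linearIsometryEquiv [SeparableSpace E] [SeparableSpace F]
    (hE : ¬ FiniteDimensional ℂ E) (hF : ¬ FiniteDimensional ℂ F) : Nonempty (E ≃ₗᵢ[ℂ] F) := by
  obtain ⟨b⟩ := exists_hilbertBasis_nat hE
  obtain ⟨c⟩ := exists_hilbertBasis_nat hF
  exact ⟨b.repr.trans c.repr.symm⟩

theorem nonempty_hilbertPow_equiv [SeparableSpace E] (hE : ¬ FiniteDimensional ℂ E) {k : ℕ}
    (i : Fin k) : Nonempty (HilbertPow E k ≃ₗᵢ[ℂ] E) := by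
  refine nonempty_linearIsometryEquiv (fun h => hE ?_) hE
  refine FiniteDimensional.of_injective (hilbertIncl i : E →L[ℂ] HilbertPow E k).toLinearMap ?_
  intro x y hxy
  have := congrArg (fun z : HilbertPow E k => z i) hxy
  simpa [hilbertIncl_apply] using this

open ContinuousLinearMap

theorem isCompactOperator_of_adjoint_comp_self {T : E →L[ℂ] F}
    (hT : IsCompactOperator (adjoint T ∘L T)) : IsCompactOperator T := by
  have hS' : TotallyBounded ((adjoint T ∘L T) '' Metric.closedBall 0 1) := by
    have h := hT.isCompact_closure_image_closedBall (𝕜₁ := ℂ) (𝕜₂ := ℂ)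
      (f := ((adjoint T ∘L T : E →L[ℂ] E) : E →ₗ[ℂ] E)) 1
    exact h.totallyBounded.subset subset_closure
  have key : TotallyBounded (T '' Metric.closedBall 0 1) := by
    rw [Metric.totallyBounded_iff]
    intro ε hε
    obtain ⟨t, hts, htf, hcov⟩ := Set.exists_subset_image_finite_and.1
      (Metric.finite_approx_of_totallyBounded hS' (ε ^ 2 / 2) (by positivity))
    refine ⟨T '' t, htf.image _, ?_⟩
    rintro _ ⟨x, hx, rfl⟩
    obtain ⟨_, ⟨z, hz, rfl⟩, hxy⟩ := Set.mem_iUnion₂.1 (hcov ⟨x, hx, rfl⟩)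
    refine Set.mem_iUnion₂.2 ⟨_, ⟨z, hz, rfl⟩, ?_⟩
    rw [Metric.mem_ball, dist_eq_norm, ← map_sub] at hxy ⊢
    have hxz : ‖x - z‖ ≤ 2 := by
      have h1 : ‖x‖ ≤ 1 := by simpa using hx
      have h2 : ‖z‖ ≤ 1 := by simpa using hts hz
      linarith [norm_sub_le x z]
    have hsq : ‖T (x - z)‖ ^ 2 ≤ ‖(adjoint T ∘L T) (x - z)‖ * ‖x - z‖ := by
      rw [apply_norm_sq_eq_inner_adjoint_left T (x - z)]
      exact (RCLike.re_le_norm _).trans (norm_inner_le_norm _ _)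
    have : ‖T (x - z)‖ ^ 2 < ε ^ 2 := by
      nlinarith [norm_nonneg ((adjoint T ∘L T) (x - z)), norm_nonneg (x - z)]
    exact lt_of_pow_lt_pow_left₀ 2 hε.le this
  exact (isCompactOperator_iff_isCompact_closure_image_closedBall (𝕜₁ := ℂ) (𝕜₂ := ℂ)
    (T : E →ₗ[ℂ] F) one_pos).2 (key.closure.isCompact_of_isClosed isClosed_closure)

end HilbertSpaces

section Contractivity

open ContinuousLinearMap

variable {H : Type*} [NormedAddCommGroup H] [InnerProductSpace ℂ H] [CompleteSpace H]

theorem calkinMk_eq_zero_iff {T : H →L[ℂ] H} : calkinMk H T = 0 ↔ IsCompactOperator T :=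
  Ideal.Quotient.eq_zero_iff_mem

theorem calkinMk_surjective : Function.Surjective (calkinMk H) :=
  Ideal.Quotient.mk_surjective

/-- A unital `*`-homomorphism into the Calkin algebra is contractive for the essential norm. -/
theorem exists_isCompactOperator_norm_sub_le {B : Type*} [CStarAlgebra B]
    (θ : B →⋆ₐ[ℂ] Calkin H) {x : B} {T : H →L[ℂ] H} (hT : calkinMk H T = θ x) {ε : ℝ}
    (hε : 0 < ε) : ∃ C : H →L[ℂ] H, IsCompactOperator C ∧ ‖T - C‖ ^ 2 ≤ ‖x‖ ^ 2 + ε := by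
  let _ := CStarAlgebra.spectralOrder B
  have _ := CStarAlgebra.spectralOrderedRing B
  have h0 : 0 ≤ algebraMap ℝ B (‖x‖ ^ 2) - star x * x := by
    have := (IsSelfAdjoint.star_mul_self x).le_algebraMap_norm_self
    rw [CStarRing.norm_star_mul_self, ← sq] at this
    exact sub_nonneg.2 this
  obtain ⟨y, hy⟩ := exists_star_mul_self_eq h0
  obtain ⟨Y, hY⟩ := calkinMk_surjective (θ y)
  let K : H →L[ℂ] H := ((‖x‖ ^ 2 : ℝ) : ℂ) • 1 - star T * T - star Y * Y
  have hK : IsCompactOperator K := by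
    rw [← calkinMk_eq_zero_iff]
    simp only [K, map_sub, map_mul, map_star, map_smul, map_one, hT, hY]
    rw [← map_star, ← map_mul, ← map_star, ← map_mul, ← hy, map_sub,
      Algebra.algebraMap_eq_smul_one, ← Complex.coe_smul, map_smul, map_one]
    abel
  obtain ⟨U, hU, hUK⟩ := hK.exists_finiteDimensional hε
  refine ⟨T * U.starProjection, ?_, ?_⟩
  · have := FiniteDimensional.proper ℂ U
    have h : IsCompactOperator (U.orthogonalProjectionOnto : H →L[ℂ] U) :=
      isCompactOperator_of_locallyCompactSpace_dom _
    exact h.clm_comp (T ∘L U.subtypeL)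
  have h1 (u : H) (hu : u ∈ Uᗮ) : ‖T u‖ ^ 2 ≤ (‖x‖ ^ 2 + ε) * ‖u‖ ^ 2 := by
    have h2 := hUK u u hu
    have h3 : ((‖x‖ ^ 2 * ‖u‖ ^ 2 - ‖T u‖ ^ 2 - ‖Y u‖ ^ 2 : ℝ) : ℂ) = ⟪u, K u⟫_ℂ := by
      simp only [K, sub_apply, smul_apply, inner_sub_right, inner_smul_right, mul_apply_eq_comp,
        one_apply_eq_self, star_eq_adjoint, adjoint_inner_right, inner_self_eq_norm_sq_to_K]
      simp
    rw [← h3, Complex.norm_real, Real.norm_eq_abs] at h2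
    nlinarith [neg_abs_le (‖x‖ ^ 2 * ‖u‖ ^ 2 - ‖T u‖ ^ 2 - ‖Y u‖ ^ 2), sq_nonneg ‖Y u‖]
  have h4 : ‖T - T * U.starProjection‖ ≤ √(‖x‖ ^ 2 + ε) := by
    refine opNorm_le_bound _ (Real.sqrt_nonneg _) fun ξ => ?_
    rw [← sq_le_sq₀ (norm_nonneg _) (by positivity), mul_pow, Real.sq_sqrt (by positivity)]
    have h5 : (T - T * U.starProjection) ξ = T (ξ - U.starProjection ξ) := by simp
    rw [h5]
    refine (h1 _ (Submodule.sub_starProjection_mem_orthogonal ξ)).trans ?_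
    gcongr
    have h6 := Submodule.norm_sq_eq_add_norm_sq_starProjection ξ U
    have h7 : Uᗮ.starProjection ξ = ξ - U.starProjection ξ := by
      rw [Submodule.starProjection_orthogonal]
      rfl
    rw [← h7, ← sq_le_sq₀ (norm_nonneg _) (norm_nonneg _)]
    linarith [sq_nonneg ‖U.starProjection ξ‖]
  calc ‖T - T * U.starProjection‖ ^ 2 ≤ √(‖x‖ ^ 2 + ε) ^ 2 := by gcongr
    _ = _ := Real.sq_sqrt (by positivity)

end Contractivity

section Compression

open ContinuousLinearMap

variable {B : Type*} [CStarAlgebra B]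
  {H : Type*} [NormedAddCommGroup H] [InnerProductSpace ℂ H] [CompleteSpace H]
  {E : Type*} [NormedAddCommGroup E] [InnerProductSpace ℂ E] [CompleteSpace E]

/-- The compression `x ↦ W* σ(x) W` of a representation. -/
def compression (σ : B →⋆ₐ[ℂ] (E →L[ℂ] E)) (W : H →L[ℂ] E) : B →ₗ[ℂ] (H →L[ℂ] H) where
  toFun x := adjoint W ∘L σ x ∘L W
  map_add' x y := by simp
  map_smul' c x := by simp

/-- The defect `(1 - W W*) σ(x) W` of a compression. -/
def compressionDefect (σ : B →⋆ₐ[ℂ] (E →L[ℂ] E)) (W : H →L[ℂ] E) : B →ₗ[ℂ] (H →L[ℂ] E) where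
  toFun x := σ x ∘L W - W ∘L adjoint W ∘L σ x ∘L W
  map_add' x y := by
    simp only [map_add, add_comp, comp_add]
    abel
  map_smul' c x := by simp [smul_sub]

variable (σ : B →⋆ₐ[ℂ] (E →L[ℂ] E)) (W : H →L[ℂ] E)

theorem compression_apply (x : B) : compression σ W x = adjoint W ∘L σ x ∘L W := rfl

theorem compressionDefect_apply (x : B) : compressionDefect σ W x =
    σ x ∘L W - W ∘L adjoint W ∘L σ x ∘L W := rfl

theorem compression_star (x : B) : compression σ W (star x) = star (compression σ W x) := by
  simp only [compression_apply, star_eq_adjoint, adjoint_comp, adjoint_adjoint, map_star]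
  rfl

theorem compression_mul (x y : B) : compression σ W (x * y) =
    compression σ W x * compression σ W y + adjoint W ∘L σ x ∘L compressionDefect σ W y := by
  ext ξ
  simp [compression_apply, compressionDefect_apply]

theorem compressionDefect_mul (x y : B) : compressionDefect σ W (x * y) =
    compressionDefect σ W x ∘L compression σ W y +
      (σ x - W ∘L adjoint W ∘L σ x) ∘L compressionDefect σ W y := by
  ext ξ
  simp [compression_apply, compressionDefect_apply]

variable {W}

theorem adjoint_compressionDefect_comp_self (hW : adjoint W ∘L W = 1) (x : B) :
    adjoint (compressionDefect σ W x) ∘L compressionDefect σ W x =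
      compression σ W (star x * x) - compression σ W (star x) * compression σ W x := by
  have hW' (ξ : H) : adjoint W (W ξ) = ξ := congrArg (· ξ) hW
  have h1 : adjoint (compressionDefect σ W x) =
      adjoint W ∘L σ (star x) - adjoint W ∘L σ (star x) ∘L W ∘L adjoint W := by
    simp only [compressionDefect_apply, map_sub, adjoint_comp, adjoint_adjoint, map_star,
      star_eq_adjoint, comp_assoc]
  rw [h1]
  ext ξ
  simp [compression_apply, compressionDefect_apply, hW']

theorem compression_one (hW : adjoint W ∘L W = 1) : compression σ W 1 = 1 := by
  rw [compression_apply, map_one, ← hW]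
  rfl

theorem compressionDefect_one (hW : adjoint W ∘L W = 1) : compressionDefect σ W 1 = 0 := by
  have hW' (ξ : H) : adjoint W (W ξ) = ξ := congrArg (· ξ) hW
  ext ξ
  simp [compressionDefect_apply, hW']

theorem StarAlgHom.continuous_of_cstarAlgebra : Continuous σ :=
  AddMonoidHomClass.continuous_of_bound σ 1 fun x => by
    simpa using NonUnitalStarAlgHom.norm_apply_le σ x

theorem continuous_compression : Continuous (compression σ W) := by
  have h : Continuous σ := StarAlgHom.continuous_of_cstarAlgebra σ
  change Continuous fun x => adjoint W ∘L σ x ∘L W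
  fun_prop

theorem continuous_compressionDefect : Continuous (compressionDefect σ W) := by
  have h : Continuous σ := StarAlgHom.continuous_of_cstarAlgebra σ
  change Continuous fun x => σ x ∘L W - W ∘L adjoint W ∘L σ x ∘L W
  fun_prop

/-- The elements on which the compression lifts `θ` and which are in its multiplicative domain
modulo the compact operators. -/
def liftDomain (hW : adjoint W ∘L W = 1) (θ : B →⋆ₐ[ℂ] Calkin H) : StarSubalgebra ℂ B where
  carrier := {x | IsCompactOperator (compressionDefect σ W x) ∧
    IsCompactOperator (compressionDefect σ W (star x)) ∧ calkinMk H (compression σ W x) = θ x}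
  mul_mem' := by
    rintro x y ⟨hx, hx', hxθ⟩ ⟨hy, hy', hyθ⟩
    refine ⟨?_, ?_, ?_⟩
    · rw [compressionDefect_mul]
      exact (hx.comp_clm _).add (hy.clm_comp (σ x - W ∘L adjoint W ∘L σ x))
    · rw [star_mul, compressionDefect_mul]
      exact (hy'.comp_clm _).add (hx'.clm_comp (σ (star y) - W ∘L adjoint W ∘L σ (star y)))
    · rw [compression_mul, map_add, map_mul, hxθ, hyθ, map_mul,
        calkinMk_eq_zero_iff.2 (hy.clm_comp (adjoint W ∘L σ x)), add_zero]
  add_mem' := by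
    rintro x y ⟨hx, hx', hxθ⟩ ⟨hy, hy', hyθ⟩
    refine ⟨?_, ?_, ?_⟩
    · rw [map_add]
      exact hx.add hy
    · rw [star_add, map_add]
      exact hx'.add hy'
    · rw [map_add, map_add, map_add, hxθ, hyθ]
  algebraMap_mem' c := by
    refine ⟨?_, ?_, ?_⟩
    · rw [Algebra.algebraMap_eq_smul_one, map_smul, compressionDefect_one σ hW, smul_zero]
      exact isCompactOperator_zero
    · rw [Algebra.algebraMap_eq_smul_one, star_smul, star_one, map_smul,
        compressionDefect_one σ hW, smul_zero]
      exact isCompactOperator_zero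
    · rw [Algebra.algebraMap_eq_smul_one, map_smul, map_smul, map_smul, compression_one σ hW,
        map_one, map_one]
  star_mem' := by
    rintro x ⟨hx, hx', hxθ⟩
    refine ⟨hx', by rwa [star_star], ?_⟩
    rw [compression_star, map_star, hxθ, map_star]

variable {σ} {hW : adjoint W ∘L W = 1} {θ : B →⋆ₐ[ℂ] Calkin H}

theorem mem_liftDomain {x : B} : x ∈ liftDomain σ hW θ ↔
    IsCompactOperator (compressionDefect σ W x) ∧
    IsCompactOperator (compressionDefect σ W (star x)) ∧
    calkinMk H (compression σ W x) = θ x := Iff.rfl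

theorem isClosed_setOf_calkinMk_compression_eq :
    IsClosed {x : B | calkinMk H (compression σ W x) = θ x} := by
  refine isClosed_of_closure_subset fun x hx => ?_
  obtain ⟨T, hT⟩ := calkinMk_surjective (θ x)
  have key : compression σ W x - T ∈
      closure {K : H →L[ℂ] H | IsCompactOperator K} := by
    rw [Metric.mem_closure_iff]
    intro ε hε
    obtain ⟨δ, hδ, hδε⟩ := Metric.continuous_iff.1 (continuous_compression σ (W := W)) x (ε / 2)
      (half_pos hε)
    obtain ⟨y, hy, hxy⟩ := Metric.mem_closure_iff.1 hx (min δ (ε / 4))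
      (lt_min hδ (by positivity))
    have h1 : calkinMk H (compression σ W y - T) = θ (y - x) := by
      rw [map_sub, map_sub, hT, Set.mem_ofPred.1 hy]
    obtain ⟨C, hC, hCε⟩ := exists_isCompactOperator_norm_sub_le θ h1 (ε := ε ^ 2 / 16)
      (by positivity)
    refine ⟨C, hC, ?_⟩
    have h2 := hδε y (by rw [dist_comm]; exact hxy.trans_le (min_le_left _ _))
    have h3 : ‖y - x‖ < ε / 4 := by
      rw [← dist_eq_norm, dist_comm]
      exact hxy.trans_le (min_le_right _ _)
    have h4 : ‖compression σ W y - T - C‖ < ε / 2 := by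
      have : ‖compression σ W y - T - C‖ ^ 2 < (ε / 2) ^ 2 := by
        nlinarith [norm_nonneg (y - x)]
      exact lt_of_pow_lt_pow_left₀ 2 (by positivity) this
    rw [dist_comm, dist_eq_norm] at h2
    rw [dist_eq_norm]
    calc ‖compression σ W x - T - C‖
        = ‖(compression σ W x - compression σ W y) + (compression σ W y - T - C)‖ := by
          congr 1
          abel
      _ ≤ _ := norm_add_le _ _
      _ < ε := by linarith
  rw [(isClosed_setOfPred_isCompactOperator).closure_eq] at key
  have := calkinMk_eq_zero_iff.2 key
  rw [map_sub, hT, sub_eq_zero] at this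
  exact this

theorem isClosed_liftDomain : IsClosed (liftDomain σ hW θ : Set B) := by
  have h1 : IsClosed {x : B | IsCompactOperator (compressionDefect σ W x)} :=
    isClosed_setOfPred_isCompactOperator.preimage (continuous_compressionDefect σ)
  exact h1.inter ((h1.preimage continuous_star).inter isClosed_setOf_calkinMk_compression_eq)

theorem mem_liftDomain_of_isSelfAdjoint {x : B} (hx : IsSelfAdjoint x)
    (h1 : calkinMk H (compression σ W x) = θ x)
    (h2 : calkinMk H (compression σ W (x * x)) = θ (x * x)) : x ∈ liftDomain σ hW θ := by
  have h3 : IsCompactOperator (compressionDefect σ W x) := by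
    refine isCompactOperator_of_adjoint_comp_self ?_
    rw [adjoint_compressionDefect_comp_self σ hW, ← calkinMk_eq_zero_iff, hx.star_eq, map_sub,
      map_mul (calkinMk H), h1, h2, map_mul, sub_self]
  exact ⟨h3, by rwa [hx.star_eq], h1⟩

theorem adjoint_hilbertIncl_apply {k : ℕ} (i : Fin k) (x : HilbertPow H k) :
    adjoint (hilbertIncl i : H →L[ℂ] HilbertPow H k) x = x i := by
  refine ext_inner_left ℂ fun h => ?_
  rw [adjoint_inner_right, hilbertIncl_apply, PiLp.inner_apply, Finset.sum_eq_single i] <;>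
    simp +contextual

/-- The matrix of a positive operator on `H ⊗ ℂᵏ` is positive. -/
theorem matrix_nonneg_of_nonneg {k : ℕ} {P : HilbertPow H k →L[ℂ] HilbertPow H k} (hP : 0 ≤ P) :
    0 ≤ (CStarMatrix.ofMatrix fun i j => adjoint (hilbertIncl i) ∘L P ∘L hilbertIncl j :
      CStarMatrix (Fin k) (Fin k) (H →L[ℂ] H)) := by
  obtain ⟨G, rfl⟩ := exists_star_mul_self_eq hP
  let R : CStarMatrix (Fin k) (Fin k) (H →L[ℂ] H) :=
    CStarMatrix.ofMatrix fun i j => adjoint (hilbertIncl i) ∘L G ∘L hilbertIncl j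
  refine (star_mul_self_nonneg R).trans_eq ?_
  ext i j ξ
  rw [CStarMatrix.mul_apply]
  simp only [CStarMatrix.star_apply, R, CStarMatrix.ofMatrix_apply_apply, star_eq_adjoint,
    adjoint_comp, adjoint_adjoint, sum_apply, mul_apply_eq_comp, comp_apply, ← map_sum]
  congr 2
  simp only [adjoint_hilbertIncl_apply, hilbertIncl_apply]
  exact hilbertPow_sum_single _

/-- The compression of a representation by an isometry is ucp. -/
theorem isUCP_compression [PartialOrder B] [StarOrderedRing B] (hW : adjoint W ∘L W = 1) :
    IsUCP (OperatorSubsystem.all B)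
      (compression σ W ∘ₗ (OperatorSubsystem.all B).toSubmodule.subtype) where
  map_one := compression_one σ hW
  map_nonneg k M hM := by
    obtain ⟨N, hN⟩ := CStarMatrix.exists_eq_sum_star_mul hM
    let T (l : Fin k) : HilbertPow H k →L[ℂ] E :=
      ∑ j, σ (N l j) ∘L W ∘L PiLp.proj 2 (fun _ : Fin k => H) j
    have hT (l j : Fin k) : T l ∘L hilbertIncl j = σ (N l j) ∘L W := by
      ext ξ
      simp only [T, comp_apply, sum_apply, hilbertIncl_apply, PiLp.proj_apply,
        hilbertPow_single_apply]
      rw [Finset.sum_eq_single j] <;> simp +contextual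
    have hP : 0 ≤ ∑ l, adjoint (T l) ∘L T l :=
      Finset.sum_nonneg fun l _ => (nonneg_iff_isPositive _).2 (isPositive_adjoint_comp_self (T l))
    refine (matrix_nonneg_of_nonneg hP).trans_eq ?_
    ext i j : 1
    have h1 : compression σ W (∑ l, star (N l i) * N l j) =
        adjoint (hilbertIncl i) ∘L (∑ l, adjoint (T l) ∘L T l) ∘L hilbertIncl j := by
      simp only [map_sum, finsetSum_comp, comp_finsetSum]
      refine Finset.sum_congr rfl fun l _ => ?_
      rw [comp_assoc, hT, ← comp_assoc, ← adjoint_comp, hT, adjoint_comp, compression_apply,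
        map_mul, map_star]
      rfl
    rw [← hN] at h1
    exact h1.symm

end Compression

section MatrixUnits

variable {A : Type*} [CStarAlgebra A] {ι : Type*} [DecidableEq ι]

/-- The matrix `a ⊗ eᵢⱼ`. -/
def CStarMatrix.unit (i j : ι) : A →ₗ[ℂ] CStarMatrix ι ι A :=
  CStarMatrix.ofMatrixₗ.toLinearMap ∘ₗ Matrix.singleLinearMap ℂ i j

namespace CStarMatrix

theorem unit_apply (i j k l : ι) (a : A) :
    CStarMatrix.unit i j a k l = if i = k ∧ j = l then a else 0 := rfl

theorem star_unit (i j : ι) (a : A) :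
    star (CStarMatrix.unit i j a) = CStarMatrix.unit j i (star a) :=
  Matrix.conjTranspose_single i j a

theorem continuous_unit (i j : ι) : Continuous (CStarMatrix.unit i j : A → CStarMatrix ι ι A) := by
  have h : Continuous (fun a : A => Matrix.single i j a) :=
    continuous_matrix fun k l => by
      simp only [Matrix.single_apply]
      split_ifs <;> fun_prop
  exact (CStarMatrix.ofMatrixL (A := A)).continuous.comp h

variable [Fintype ι]

theorem unit_mul_unit (i j k : ι) (a b : A) :
    CStarMatrix.unit i j a * CStarMatrix.unit j k b = CStarMatrix.unit i k (a * b) :=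
  Matrix.single_mul_single_same (c := a) (l := ι) (m := ι) (n := ι) i j k b

theorem unit_mul_mul_unit (i j : ι) (M : CStarMatrix ι ι A) (a b : A) :
    CStarMatrix.unit i i a * M * CStarMatrix.unit j j b = CStarMatrix.unit i j (a * M i j * b) :=
  Matrix.single_mul_mul_single i i j j a M b

/-- The algebra of all `a` with `a ⊗ eᵢᵢ ∈ D`. -/
def cornerSubalgebra (D : StarSubalgebra ℂ (CStarMatrix ι ι A)) (i : ι)
    (hi : CStarMatrix.unit i i 1 ∈ D) : StarSubalgebra ℂ A where
  carrier := {a | CStarMatrix.unit i i a ∈ D}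
  mul_mem' {a b} ha hb := by
    rw [Set.mem_ofPred, ← unit_mul_unit i i i]
    exact mul_mem ha hb
  add_mem' {a b} ha hb := by
    rw [Set.mem_ofPred, map_add]
    exact add_mem ha hb
  algebraMap_mem' c := by
    rw [Set.mem_ofPred, Algebra.algebraMap_eq_smul_one, map_smul]
    exact D.smul_mem hi c
  star_mem' {a} ha := by
    rw [Set.mem_ofPred, ← star_unit]
    exact star_mem ha

theorem mem_cornerSubalgebra {D : StarSubalgebra ℂ (CStarMatrix ι ι A)} {i : ι}
    {hi : CStarMatrix.unit i i 1 ∈ D} {a : A} :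
    a ∈ cornerSubalgebra D i hi ↔ CStarMatrix.unit i i a ∈ D := Iff.rfl

theorem isClosed_cornerSubalgebra {D : StarSubalgebra ℂ (CStarMatrix ι ι A)}
    (hD : IsClosed (D : Set (CStarMatrix ι ι A))) {i : ι} (hi : CStarMatrix.unit i i 1 ∈ D) :
    IsClosed (cornerSubalgebra D i hi : Set A) :=
  hD.preimage (continuous_unit i i)

/-- The diagonal matrices with scalar entries. -/
def scalarDiagonal : (ι → ℂ) →ₐ[ℂ] CStarMatrix ι ι A where
  toFun f := CStarMatrix.ofMatrix (Matrix.diagonal fun i => algebraMap ℂ A (f i))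
  map_one' := by
    simp only [Pi.one_apply, map_one]
    exact Matrix.diagonal_one
  map_mul' f g := by
    simp only [Pi.mul_apply, map_mul]
    exact (Matrix.diagonal_mul_diagonal _ _).symm
  map_zero' := by
    simp only [Pi.zero_apply, map_zero]
    exact Matrix.diagonal_zero
  map_add' f g := by
    simp only [Pi.add_apply, map_add]
    exact (Matrix.diagonal_add (n := ι) (α := A) _ _).symm
  commutes' c := by
    ext i j
    rw [CStarMatrix.algebraMap_apply]
    exact Matrix.diagonal_apply _ i j

theorem scalarDiagonal_apply (f : ι → ℂ) (i j : ι) :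
    scalarDiagonal (A := A) f i j = if i = j then algebraMap ℂ A (f i) else 0 :=
  Matrix.diagonal_apply _ i j

theorem isSelfAdjoint_scalarDiagonal (f : ι → ℝ) :
    IsSelfAdjoint (scalarDiagonal (A := A) fun i => (f i : ℂ)) := by
  ext i j
  rw [star_apply, scalarDiagonal_apply, scalarDiagonal_apply]
  by_cases h : i = j
  · subst h
    simp [← algebraMap_star_comm]
  · simp [h, Ne.symm h]

end CStarMatrix

theorem StarSubalgebra.exists_inv_mem {C : StarSubalgebra ℂ A} (hC : IsClosed (C : Set A)) {v : A}
    (hv : IsSelfAdjoint v) (hu : IsUnit v) (hvC : v ∈ C) : ∃ w ∈ C, w * v = 1 ∧ v * w = 1 := by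
  obtain ⟨u, rfl⟩ := hu
  refine ⟨(u⁻¹ : Aˣ), ?_, u.inv_mul, u.mul_inv⟩
  rw [← cfc_inv_id (R := ℝ) u hv]
  exact cfc_mem _ hvC

variable [PartialOrder A] [StarOrderedRing A]

theorem StarSubalgebra.mem_of_mul_self_mem {C : StarSubalgebra ℂ A} (hC : IsClosed (C : Set A))
    {v : A} (hv : 0 ≤ v) (hvC : v * v ∈ C) : v ∈ C := by
  have hvv : 0 ≤ v * v := by
    simpa [(IsSelfAdjoint.of_nonneg hv).star_eq] using star_mul_self_nonneg v
  rw [← CFC.sqrt_mul_self v hv, CFC.sqrt_eq_real_sqrt (v * v) hvv]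
  exact cfcₙ_mem _ hvC

namespace CStarMatrix

variable [Fintype ι]

/-- A closed algebra that contains the diagonal matrix units and the matrix `(vᵢ vⱼ)ᵢⱼ` contains
`a ⊗ eⱼⱼ` for all `a` in the closed algebra generated by the `vᵢ` with `i ∈ J`, if these are
positive and invertible. -/
theorem unit_mem_of_closed {D : StarSubalgebra ℂ (CStarMatrix ι ι A)}
    (hD : IsClosed (D : Set (CStarMatrix ι ι A))) (hunit : ∀ i, CStarMatrix.unit i i 1 ∈ D)
    {v : ι → A} {J : Set ι} (hv : ∀ i ∈ J, IsStrictlyPositive (v i))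
    (hp : (CStarMatrix.ofMatrix fun i j => v i * v j) ∈ D)
    (hgen : ∀ C : StarSubalgebra ℂ A, IsClosed (C : Set A) → (∀ i ∈ J, v i ∈ C) → C = ⊤)
    {j : ι} (hj : j ∈ J) (a : A) : CStarMatrix.unit j j a ∈ D := by
  have h1 (i k : ι) : CStarMatrix.unit i k (v i * v k) ∈ D := by
    have h := mul_mem (mul_mem (hunit i) hp) (hunit k)
    rw [unit_mul_mul_unit] at h
    simpa [ofMatrix_apply_apply] using h
  have hC (i : ι) := isClosed_cornerSubalgebra hD (hunit i)
  have h2 (i : ι) (hi : i ∈ J) : v i ∈ cornerSubalgebra D i (hunit i) :=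
    StarSubalgebra.mem_of_mul_self_mem (hC i) (hv i hi).nonneg (h1 i i)
  have h3 (i : ι) (hi : i ∈ J) := StarSubalgebra.exists_inv_mem (hC i)
    (IsSelfAdjoint.of_nonneg (hv i hi).nonneg) (hv i hi).isUnit (h2 i hi)
  have h4 (i k : ι) (hi : i ∈ J) (hk : k ∈ J) : CStarMatrix.unit i k (1 : A) ∈ D := by
    obtain ⟨w, hw, hwv, -⟩ := h3 i hi
    obtain ⟨z, hz, -, hvz⟩ := h3 k hk
    have h := mul_mem (mul_mem (mem_cornerSubalgebra.1 hw) (h1 i k)) (mem_cornerSubalgebra.1 hz)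
    rwa [unit_mul_unit, unit_mul_unit, ← mul_assoc, hwv, one_mul, hvz] at h
  have h5 : cornerSubalgebra D j (hunit j) = ⊤ := by
    refine hgen _ (hC j) fun i hi => ?_
    have h := mul_mem (mul_mem (h4 j i hj hi) (mem_cornerSubalgebra.1 (h2 i hi))) (h4 i j hi hj)
    rwa [unit_mul_unit, unit_mul_unit, one_mul, mul_one] at h
  exact mem_cornerSubalgebra.1 (h5 ▸ StarSubalgebra.mem_top)

/-- An algebra that contains a diagonal matrix with distinct scalar entries contains the diagonal
matrix units. -/
theorem unit_mem_of_scalarDiagonal_mem {D : StarSubalgebra ℂ (CStarMatrix ι ι A)} {f : ι → ℂ}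
    (hf : Function.Injective f) (hD : scalarDiagonal f ∈ D) (i : ι) :
    CStarMatrix.unit i i (1 : A) ∈ D := by
  let p : Polynomial ℂ := Lagrange.basis Finset.univ f i
  have h1 : Polynomial.aeval (scalarDiagonal (A := A) f) p ∈ D := by
    have h : Algebra.adjoin ℂ {scalarDiagonal (A := A) f} ≤ D.toSubalgebra :=
      Algebra.adjoin_le (by simpa using hD)
    exact h (Polynomial.aeval_mem_adjoin_singleton ℂ _)
  have h2 : Polynomial.aeval f p = Pi.single i 1 := by
    ext j
    rw [Polynomial.aeval_fn_apply]
    by_cases h : j = i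
    · subst h
      simpa using Lagrange.eval_basis_self hf.injOn (Finset.mem_univ j)
    · simpa [h] using Lagrange.eval_basis_of_ne (v := f) (Ne.symm h) (Finset.mem_univ j)
  rw [Polynomial.aeval_algHom_apply, h2] at h1
  convert h1
  ext k l
  rw [unit_apply, scalarDiagonal_apply]
  by_cases hk : k = i
  · subst hk
    simp
  · simp [hk, Ne.symm hk]

end CStarMatrix

end MatrixUnits

section Generators

open scoped ComplexStarModule

variable {A : Type*} [CStarAlgebra A]

theorem StarSubalgebra.algebraMap_real_mem (C : StarSubalgebra ℂ A) (r : ℝ) :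
    algebraMap ℝ A r ∈ C := by
  rw [Algebra.algebraMap_eq_smul_one, ← Complex.coe_smul]
  exact C.smul_mem (one_mem C) _

variable [PartialOrder A] [StarOrderedRing A]

theorem IsSelfAdjoint.isStrictlyPositive_add_norm_add_one {a : A} (ha : IsSelfAdjoint a) :
    IsStrictlyPositive (a + algebraMap ℝ A ‖a‖ + 1) :=
  .nonneg_add (neg_le_iff_add_nonneg.1 ha.neg_algebraMap_norm_le_self) isStrictlyPositive_one

/-- A finitely generated C⋆-algebra is generated by finitely many positive invertible elements. -/
theorem IsFinitelyGeneratedCStar.exists_isStrictlyPositive (hA : IsFinitelyGeneratedCStar A) :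
    ∃ n, 2 ≤ n ∧ ∃ h : Fin n → A, (∀ i, IsStrictlyPositive (h i)) ∧
      ∀ C : StarSubalgebra ℂ A, IsClosed (C : Set A) → (∀ i, h i ∈ C) → C = ⊤ := by
  obtain ⟨F, hF⟩ := hA
  let p (a : A) : A := a + algebraMap ℝ A ‖a‖ + 1
  let L : List A := 1 :: 1 :: F.toList.flatMap fun x => [p (ℜ x : A), p (ℑ x : A)]
  have hL (x : A) (hx : x ∈ L) : IsStrictlyPositive x := by
    simp only [L, List.mem_cons, List.mem_flatMap, List.not_mem_nil, or_false] at hx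
    obtain rfl | rfl | ⟨y, -, rfl | rfl⟩ := hx
    · exact isStrictlyPositive_one
    · exact isStrictlyPositive_one
    · exact (ℜ y).2.isStrictlyPositive_add_norm_add_one
    · exact (ℑ y).2.isStrictlyPositive_add_norm_add_one
  refine ⟨L.length, by simp [L], L.get, fun i => hL _ (L.get_mem i), fun C hC hLC => ?_⟩
  have hmem (x : A) (hx : x ∈ L) : x ∈ C := by
    obtain ⟨i, rfl⟩ := List.mem_iff_get.1 hx
    exact hLC i
  have hp {a : A} (ha : p a ∈ C) : a ∈ C := by
    have h := sub_mem (sub_mem ha (one_mem C)) (C.algebraMap_real_mem ‖a‖)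
    simpa [p] using h
  rw [eq_top_iff, ← hF]
  refine StarSubalgebra.topologicalClosure_minimal (StarAlgebra.adjoin_le fun x hx => ?_) hC
  have hx' (y : A) (hy : y = p (ℜ x : A) ∨ y = p (ℑ x : A)) : y ∈ C := by
    refine hmem y ?_
    simp only [L, List.mem_cons, List.mem_flatMap, List.not_mem_nil, or_false]
    exact .inr (.inr ⟨x, by simpa using hx, hy⟩)
  rw [← realPart_add_I_smul_imaginaryPart x]
  exact add_mem (hp (hx' _ (.inl rfl))) (C.smul_mem (hp (hx' _ (.inr rfl))) _)

/-- The generators can be completed to a unit vector. -/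
theorem IsFinitelyGeneratedCStar.exists_sum_mul_self_eq_one (hA : IsFinitelyGeneratedCStar A) :
    ∃ n, 2 ≤ n ∧ ∃ v : Fin (n + 1) → A, (∀ i, IsSelfAdjoint (v i)) ∧ ∑ i, v i * v i = 1 ∧
      (∀ i ∈ ({0}ᶜ : Set (Fin (n + 1))), IsStrictlyPositive (v i)) ∧
      ∀ C : StarSubalgebra ℂ A, IsClosed (C : Set A) →
        (∀ i ∈ ({0}ᶜ : Set (Fin (n + 1))), v i ∈ C) → C = ⊤ := by
  obtain ⟨n, hn, h, hpos, hgen⟩ := hA.exists_isStrictlyPositive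
  let X : A := ∑ i, h i * h i
  have hX : 0 ≤ X := Finset.sum_nonneg fun i _ => by
    simpa [(IsSelfAdjoint.of_nonneg (hpos i).nonneg).star_eq] using star_mul_self_nonneg (h i)
  let c : ℝ := (√(‖X‖ + 1))⁻¹
  have hc : 0 < c := inv_pos.2 (Real.sqrt_pos.2 (by positivity))
  have hc2 : c * c * (‖X‖ + 1) = 1 := by
    have h1 := Real.mul_self_sqrt (show 0 ≤ ‖X‖ + 1 by positivity)
    have h2 : √(‖X‖ + 1) ≠ 0 := (Real.sqrt_pos.2 (by positivity)).ne'
    simp only [c]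
    field_simp
    rw [sq, h1]
  have hcX : 0 ≤ 1 - (c * c) • X := by
    rw [sub_nonneg]
    calc (c * c) • X ≤ (c * c) • algebraMap ℝ A (‖X‖ + 1) := by
          refine smul_le_smul_of_nonneg_left ?_ (by positivity)
          refine (IsSelfAdjoint.of_nonneg hX).le_algebraMap_norm_self.trans ?_
          exact algebraMap_mono A (by simp)
      _ = 1 := by
          rw [Algebra.algebraMap_eq_smul_one, smul_smul, hc2, one_smul]
  have hv (i : Fin n) : IsStrictlyPositive (c • h i) :=
    (hpos i).smul hc
  refine ⟨n, hn, Fin.cons (CFC.sqrt (1 - (c * c) • X)) fun i => c • h i, ?_, ?_, ?_, ?_⟩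
  · refine Fin.cases ?_ fun i => ?_
    · exact IsSelfAdjoint.of_nonneg (CFC.sqrt_nonneg _)
    · exact IsSelfAdjoint.of_nonneg (hv i).nonneg
  · rw [Fin.sum_univ_succ]
    simp only [Fin.cons_zero, Fin.cons_succ, smul_mul_smul_comm, ← Finset.smul_sum]
    rw [CFC.sqrt_mul_sqrt_self _ hcX]
    exact sub_add_cancel _ _
  · refine Fin.cases (fun h0 => absurd rfl h0) fun i _ => ?_
    exact hv i
  · intro C hC hvC
    refine hgen C hC fun i => ?_
    have h1 : c • h i ∈ C := hvC i.succ (Fin.succ_ne_zero i)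
    have h2 := mul_mem (C.algebraMap_real_mem c⁻¹) h1
    rwa [Algebra.algebraMap_eq_smul_one, smul_mul_smul_comm, inv_mul_cancel₀ hc.ne', one_smul,
      one_mul] at h2

end Generators

section OperatorSystem

variable {B : Type*} [CStarAlgebra B]

/-- The operator subsystem spanned by a family of self-adjoint elements containing the unit. -/
def OperatorSubsystem.spanOfSelfAdjoint {κ : Type*} (b : κ → B) (hb : ∀ k, IsSelfAdjoint (b k))
    (k₀ : κ) (h₀ : b k₀ = 1) : OperatorSubsystem B where
  toSubmodule := Submodule.span ℂ (Set.range b)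
  one_mem' := Submodule.subset_span ⟨k₀, h₀⟩
  star_mem' {x} hx := by
    change star x ∈ Submodule.span ℂ (Set.range b)
    induction hx using Submodule.span_induction with
    | mem x hx =>
      obtain ⟨k, rfl⟩ := hx
      rw [(hb k).star_eq]
      exact Submodule.subset_span ⟨k, rfl⟩
    | zero => simp
    | add x y _ _ hx hy => simpa using add_mem hx hy
    | smul c x _ hx => simpa using Submodule.smul_mem _ _ hx

variable {A : Type*} [CStarAlgebra A] {n : ℕ}

/-- The diagonal matrix with entries `0, 1, …, n`. -/
def gradingMatrix (A : Type*) [CStarAlgebra A] (n : ℕ) :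
    CStarMatrix (Fin (n + 1)) (Fin (n + 1)) A :=
  CStarMatrix.scalarDiagonal fun i => ((i : ℕ) : ℂ)

theorem gradingMatrix_apply (i j : Fin (n + 1)) :
    gradingMatrix A n i j = if i = j then ((i : ℕ) : A) else 0 := by
  rw [gradingMatrix, CStarMatrix.scalarDiagonal_apply, map_natCast]

theorem isSelfAdjoint_gradingMatrix : IsSelfAdjoint (gradingMatrix A n) := by
  simpa [gradingMatrix] using
    CStarMatrix.isSelfAdjoint_scalarDiagonal (A := A) fun i : Fin (n + 1) => ((i : ℕ) : ℝ)

/-- The rank one matrix `(vᵢ vⱼ)ᵢⱼ`. -/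
def rankOneMatrix (v : Fin (n + 1) → A) : CStarMatrix (Fin (n + 1)) (Fin (n + 1)) A :=
  CStarMatrix.ofMatrix fun i j => v i * v j

theorem isSelfAdjoint_rankOneMatrix {v : Fin (n + 1) → A} (hv : ∀ i, IsSelfAdjoint (v i)) :
    IsSelfAdjoint (rankOneMatrix v) := by
  ext i j
  simp [rankOneMatrix, CStarMatrix.star_apply, CStarMatrix.ofMatrix_apply_apply, (hv _).star_eq]

theorem rankOneMatrix_mul_self {v : Fin (n + 1) → A} (hv : ∑ i, v i * v i = 1) :
    rankOneMatrix v * rankOneMatrix v = rankOneMatrix v := by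
  ext i j
  rw [CStarMatrix.mul_apply]
  simp only [rankOneMatrix, CStarMatrix.ofMatrix_apply_apply]
  calc ∑ k, v i * v k * (v k * v j) = v i * (∑ k, v k * v k) * v j := by
        simp only [Finset.mul_sum, Finset.sum_mul, mul_assoc]
    _ = v i * v j := by rw [hv, mul_one]

/-- The elements `1, d, d², p` with `d` diagonal and `p` of rank one. -/
def systemBasis (v : Fin (n + 1) → A) : Fin 4 → CStarMatrix (Fin (n + 1)) (Fin (n + 1)) A :=
  ![1, gradingMatrix A n, gradingMatrix A n * gradingMatrix A n, rankOneMatrix v]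

theorem linearIndependent_systemBasis [Nontrivial A] (hn : 2 ≤ n) {v : Fin (n + 1) → A}
    (hv : ∀ i ∈ ({0}ᶜ : Set (Fin (n + 1))), IsUnit (v i)) :
    LinearIndependent ℂ (systemBasis v) := by
  have hdd (i j : Fin (n + 1)) : (gradingMatrix A n * gradingMatrix A n) i j =
      if i = j then ((i : ℕ) : A) * ((i : ℕ) : A) else 0 := by
    rw [CStarMatrix.mul_apply, Finset.sum_eq_single i] <;>
      simp +contextual [gradingMatrix_apply, eq_comm]
  rw [Fintype.linearIndependent_iff]
  intro g hg
  have key (i j : Fin (n + 1)) : (if i = j then g 0 + g 1 * (i : ℕ) + g 2 * ((i : ℕ) * (i : ℕ))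
      else 0) • (1 : A) + g 3 • (v i * v j) = 0 := by
    have h := congrFun (congrFun hg i) j
    rw [Fin.sum_univ_four] at h
    change g 0 • (1 : CStarMatrix _ _ A) i j + g 1 • gradingMatrix A n i j +
      g 2 • (gradingMatrix A n * gradingMatrix A n) i j + g 3 • (v i * v j) = 0 at h
    rw [CStarMatrix.one_apply, gradingMatrix_apply, hdd] at h
    rw [← h]
    congr 1
    split_ifs
    · simp [add_smul, mul_smul, Nat.cast_smul_eq_nsmul]
    · simp
  let e (m : ℕ) (hm : m ≤ 2) : Fin (n + 1) := ⟨m, by omega⟩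
  have h3 : g 3 = 0 := by
    have h := key (e 1 (by norm_num)) (e 2 (by norm_num))
    have hu : IsUnit (v (e 1 (by norm_num)) * v (e 2 (by norm_num))) :=
      (hv _ (by simp [e, Fin.ext_iff])).mul (hv _ (by simp [e, Fin.ext_iff]))
    rw [if_neg (by simp [e]), zero_smul, zero_add] at h
    exact (smul_eq_zero.1 h).resolve_right hu.ne_zero
  have key' (i : Fin (n + 1)) : g 0 + g 1 * (i : ℕ) + g 2 * ((i : ℕ) * (i : ℕ)) = 0 := by
    have h := key i i
    rw [if_pos rfl, h3, zero_smul, add_zero] at h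
    exact (smul_eq_zero.1 h).resolve_right one_ne_zero
  have k0 := key' (e 0 (by norm_num))
  have k1 := key' (e 1 (by norm_num))
  have k2 := key' (e 2 (by norm_num))
  simp only [e, Nat.cast_zero, Nat.cast_one, Nat.cast_ofNat, mul_zero, mul_one, add_zero] at k0 k1 k2
  have h2 : g 2 = 0 := by linear_combination (1 / 2) * k0 - k1 + (1 / 2) * k2
  have h1 : g 1 = 0 := by linear_combination k1 - k0 - h2
  intro i
  fin_cases i
  exacts [k0, h1, h2, h3]

end OperatorSystem

section Main

open ContinuousLinearMap

variable {A : Type*} [CStarAlgebra A]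

/-- The embedding `a ↦ a ⊗ 1` into the matrices over `A`. -/
def CStarMatrix.scalarEmbedding (ι A : Type*) [Fintype ι] [DecidableEq ι] [CStarAlgebra A] :
    A →⋆ₐ[ℂ] CStarMatrix ι ι A where
  toFun a := CStarMatrix.ofMatrix (Matrix.diagonal fun _ => a)
  map_one' := Matrix.diagonal_one
  map_mul' a b := (Matrix.diagonal_mul_diagonal _ _).symm
  map_zero' := Matrix.diagonal_zero
  map_add' a b := (Matrix.diagonal_add (n := ι) (α := A) _ _).symm
  commutes' c := by
    ext i j
    rw [CStarMatrix.algebraMap_apply]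
    exact Matrix.diagonal_apply _ i j
  map_star' a := (Matrix.diagonal_conjTranspose _).symm

theorem CStarMatrix.scalarEmbedding_apply {ι : Type*} [Fintype ι] [DecidableEq ι] (a : A)
    (i j : ι) : CStarMatrix.scalarEmbedding ι A a i j = if i = j then a else 0 :=
  Matrix.diagonal_apply _ i j

theorem CStarMatrix.scalarEmbedding_mul_unit {ι : Type*} [Fintype ι] [DecidableEq ι] (i j : ι)
    (a b : A) : CStarMatrix.scalarEmbedding ι A a * CStarMatrix.unit i j b =
      CStarMatrix.unit i j (a * b) := by
  ext k l
  rw [CStarMatrix.mul_apply, Finset.sum_eq_single k] <;>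
    simp +contextual [CStarMatrix.scalarEmbedding_apply, CStarMatrix.unit_apply, eq_comm]

variable {H : Type*} [NormedAddCommGroup H] [InnerProductSpace ℂ H] [CompleteSpace H]

theorem calkinConj_ampliation_unit {k : ℕ} (V : HilbertPow H k ≃ₗᵢ[ℂ] H) (ρ : A →⋆ₐ[ℂ] Calkin H)
    (i j : Fin k) (a : A) : (calkinConj V).comp (ampliation k ρ) (CStarMatrix.unit i j a) =
      calkinMk H (unitaryCol V i) * ρ a * star (calkinMk H (unitaryCol V j)) := by
  have h (k l) : ampliation _ ρ (CStarMatrix.unit i j a) k l =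
      if i = k ∧ j = l then ρ a else 0 := by
    change ρ (CStarMatrix.unit i j a k l) = _
    rw [CStarMatrix.unit_apply]
    split_ifs <;> simp
  rw [StarAlgHom.comp_apply, calkinConj_apply, Finset.sum_eq_single i, Finset.sum_eq_single j] <;>
    simp +contextual [h, eq_comm]

/-- If the compression of a representation of the matrix algebra is multiplicative modulo the
compact operators at the corner embedding, then `ρ` has a ucp lift. -/
theorem hasUCPLift_of_unit_mem_liftDomain [PartialOrder A] [StarOrderedRing A] {k : ℕ}
    {V : HilbertPow H k ≃ₗᵢ[ℂ] H} {ρ : A →⋆ₐ[ℂ] Calkin H}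
    {E : Type*} [NormedAddCommGroup E] [InnerProductSpace ℂ E] [CompleteSpace E]
    {σ : CStarMatrix (Fin k) (Fin k) A →⋆ₐ[ℂ] (E →L[ℂ] E)} {W : H →L[ℂ] E}
    (hW : adjoint W ∘L W = 1) {j : Fin k}
    (hD : ∀ a, CStarMatrix.unit j j a ∈ liftDomain σ hW ((calkinConj V).comp (ampliation k ρ))) :
    HasUCPLift (OperatorSubsystem.all A) ρ := by
  have hV : adjoint (unitaryCol V j) ∘L unitaryCol V j = 1 :=
    (star_unitaryCol_mul V j j).trans (if_pos rfl)
  let U : H →L[ℂ] E := W ∘L unitaryCol V j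
  have hU : adjoint U ∘L U = 1 := by
    rw [adjoint_comp, comp_assoc, ← comp_assoc (adjoint W), hW]
    exact hV
  refine ⟨_, isUCP_compression (σ := σ.comp (CStarMatrix.scalarEmbedding (Fin k) A)) hU, ?_⟩
  rintro ⟨a, -⟩
  have h1 : compression (σ.comp (CStarMatrix.scalarEmbedding (Fin k) A)) U a =
      star (unitaryCol V j) * compression σ W (CStarMatrix.scalarEmbedding (Fin k) A a) *
        unitaryCol V j := by
    ext ξ
    simp [compression_apply, U, star_eq_adjoint]
  have h2 := (mem_liftDomain.1 (hD a)).2.2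
  obtain ⟨h3, -, h4⟩ := mem_liftDomain.1 (hD 1)
  have h5 := calkinConj_ampliation_unit V ρ j j a
  have h6 := calkinConj_ampliation_unit V ρ j j 1
  have h7 := CStarMatrix.scalarEmbedding_mul_unit j j a 1
  rw [mul_one] at h7
  have h10 : calkinMk H (adjoint W ∘L σ (CStarMatrix.scalarEmbedding (Fin k) A a) ∘L
      compressionDefect σ W (CStarMatrix.unit j j 1)) = 0 :=
    calkinMk_eq_zero_iff.2
      (h3.clm_comp (adjoint W ∘L σ (CStarMatrix.scalarEmbedding (Fin k) A a)))
  rw [← h7, compression_mul, map_add, map_mul, h4, h7, h5, h6, map_one, mul_one, h10,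
    add_zero] at h2
  have h8 := calkinMk_star_unitaryCol_mul V j j
  rw [if_pos rfl] at h8
  change calkinMk H (compression _ U a) = ρ a
  rw [h1, map_mul, map_mul, map_star]
  have h9 := congrArg (fun q => star (calkinMk H (unitaryCol V j)) * q *
    calkinMk H (unitaryCol V j)) h2
  simp only [mul_assoc, h8, mul_one] at h9
  rw [calkinMk_star_unitaryCol_mul_assoc, if_pos rfl] at h9
  rw [mul_assoc]
  exact h9

/-- The operator subsystem spanned by `1, d, d², p`. -/
def gradedSystem {n : ℕ} {v : Fin (n + 1) → A} [PartialOrder A] [StarOrderedRing A]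
    (hv : ∀ i, IsSelfAdjoint (v i)) :
    OperatorSubsystem (CStarMatrix (Fin (n + 1)) (Fin (n + 1)) A) :=
  OperatorSubsystem.spanOfSelfAdjoint (systemBasis v)
    (fun k => by
      fin_cases k
      · exact IsSelfAdjoint.one _
      · exact isSelfAdjoint_gradingMatrix
      · exact (IsSelfAdjoint.commute_iff isSelfAdjoint_gradingMatrix
          isSelfAdjoint_gradingMatrix).1 (.refl _)
      · exact isSelfAdjoint_rankOneMatrix hv) 0 rfl

end Main

theorem mainTheorem6 {A : Type*} [CStarAlgebra A] [PartialOrder A] [StarOrderedRing A]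
    {H : Type*} [NormedAddCommGroup H] [InnerProductSpace ℂ H] [CompleteSpace H]
    [TopologicalSpace.SeparableSpace H] (hH : ¬ FiniteDimensional ℂ H)
    (hA : IsFinitelyGeneratedCStar A) (hExt : ¬ CStarExt.IsGroup A H)
    (ρ : A →⋆ₐ[ℂ] Calkin H) (hρ : Function.Injective ρ)
    (hlift : ¬ HasUCPLift (OperatorSubsystem.all A) ρ) :
    ∃ n : ℕ, 1 ≤ n ∧
      ∃ (S : OperatorSubsystem (CStarMatrix (Fin (n + 1)) (Fin (n + 1)) A))
        (V : HilbertPow H (n + 1) ≃ₗᵢ[ℂ] H),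
        Module.finrank ℂ S.toSubmodule = 4 ∧
        ¬ HasUCPLift S ((calkinConj V).comp (ampliation (n + 1) ρ)) := by
  have : Nontrivial A := by
    by_contra hA
    rw [not_nontrivial_iff_subsingleton] at hA
    have h : calkinMk H 1 = 0 := by
      rw [map_one, ← map_one ρ, Subsingleton.elim (1 : A) 0, map_zero]
    exact hH (FiniteDimensional.of_isCompactOperator_id (𝕜 := ℂ) (calkinMk_eq_zero_iff.1 h))
  obtain ⟨n, hn, v, hv, hv1, hpos, hgen⟩ := hA.exists_sum_mul_self_eq_one
  obtain ⟨V⟩ := nonempty_hilbertPow_equiv hH (0 : Fin (n + 1))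
  refine ⟨n, by omega, gradedSystem hv, V, ?_, ?_⟩
  · exact (finrank_span_eq_card (linearIndependent_systemBasis hn
      fun i hi => (hpos i hi).isUnit)).trans (by simp)
  rintro ⟨ψ, hψ, hψl⟩
  obtain ⟨Φ, W, hW⟩ := hψ.exists_dilation
  have hWW : W.toContinuousLinearMap.adjoint ∘L W.toContinuousLinearMap = 1 := by
    ext1 ξ
    refine ext_inner_left ℂ fun η => ?_
    rw [ContinuousLinearMap.comp_apply, ContinuousLinearMap.adjoint_inner_right]
    exact W.inner_map_map η ξ
  have hmem (k : Fin 4) : systemBasis v k ∈ (gradedSystem hv).toSubmodule :=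
    Submodule.subset_span ⟨k, rfl⟩
  have hbasis (k : Fin 4) :
      calkinMk H (compression Φ.rep W.toContinuousLinearMap (systemBasis v k)) =
        (calkinConj V).comp (ampliation (n + 1) ρ) (systemBasis v k) := by
    rw [← hψl ⟨_, hmem k⟩, hW]
    rfl
  have hd : gradingMatrix A n ∈
      liftDomain Φ.rep hWW ((calkinConj V).comp (ampliation (n + 1) ρ)) :=
    mem_liftDomain_of_isSelfAdjoint isSelfAdjoint_gradingMatrix (hbasis 1) (hbasis 2)
  have hp : rankOneMatrix v ∈
      liftDomain Φ.rep hWW ((calkinConj V).comp (ampliation (n + 1) ρ)) :=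
    mem_liftDomain_of_isSelfAdjoint (isSelfAdjoint_rankOneMatrix hv) (hbasis 3)
      (by rw [rankOneMatrix_mul_self hv1]; exact hbasis 3)
  refine hlift (hasUCPLift_of_unit_mem_liftDomain (V := V) (σ := Φ.rep) hWW (j := Fin.last n)
    fun a => ?_)
  exact CStarMatrix.unit_mem_of_closed isClosed_liftDomain
    (CStarMatrix.unit_mem_of_scalarDiagonal_mem
      (fun i j h => Fin.ext (Nat.cast_injective h)) hd)
    hpos hp hgen (by simp [Fin.ext_iff]; omega) a

end
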